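/- Let $\mathfrak H=\{\tau\in\mathbb C:\operatorname{Im}\tau>0\}$, let $E_2(\tau)=1-24\sum_{n\ge1}\sigma_1(n)e^{2\pi i n\tau}$ and $\gamma=\frac{\pi i}{3}E_2$ on $\mathfrak H$. On $M=\mathbb C^2\times\mathfrak H$ with coordinates $(t_1,t_2,t_3)$ put $$F=\tfrac12t_1^2t_3+\tfrac12t_1t_2^2-\tfrac{t_2^4}{16}\gamma(t_3),\qquad E=t_1\partial_{t_1}+\tfrac12t_2\partial_{t_2}.$$ Write $C_{ijk}=\partial_{t_i}\partial_{t_j}\partial_{t_k}F$, $\eta_{ij}=C_{1ij}$, $(\eta^{ij})=(\eta_{ij})^{-1}$, $C_{ij}^k=\sum_l\eta^{kl}C_{lij}$ and $\partial_{t_i}\circ\partial_{t_j}=\sum_kC_{ij}^k\partial_{t_k}$. **Theorem.** 1. $F$ and $E$ endow $M$ with the structure of a Frobenius manifold of charge $d=1$ with flat coordinates $t_1,t_2,t_3$: the matrix $(\eta_{ij})$ is constant and nondegenerate, $\circ$ is commutative and associative with unit $\partial_{t_1}$, and $E$ is an affine vector field with $[\partial_{t_1},E]=\partial_{t_1}$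 and $E(F)=(3-d)F$ up to a polynomial of degree at most $2$. Its flat metric is $$\eta=\sum_{i,j}\eta_{ij}\,dt_i\,dt_j=dt_2^2+2\,dt_1dt_3 .$$ 2. There are continuous functions $\mathscr N_1,\mathscr N_2,\mathscr N_3$ on $\mathfrak H$ whose values at each $\tau\in\mathfrak H$ are the three roots, counted with multiplicity, of the cubic $$\mathscr N^3+\tfrac32\gamma(\tau)\mathscr N^2+\tfrac32\gamma'(\tau)\mathscr N+\tfrac14\gamma''(\tau).$$ For every such choice of $\mathscr N_1,\mathscr N_2,\mathscr N_3$, the three roots are distinct at every $\tau\in\mathfrak H$, and the functions $$u_i=t_1+\tfrac12t_2^2\,\mathscr N_i(t_3),\qquad i=1,2,3,$$ are the canonical coordinates of the Frobenius manifold on $\mathbb C\times\mathbb C^\times\times\mathfrak H$. That is, near every point $p$ of this set they are holomorphic local coordinates with $\partial_{u_i}\circ\partial_{u_j}=\delta_{ij}\partial_{u_i}$ and $E=\sum_iu_i\partial_{u_i}$, and any holomorphic local coordinates near $p$ with these two properties coincide near $p$ with $u_1,u_2,u_3$ up to a permutation. 3. On $\mathbb C^3$ with the standard Poisson structure $\{\Omega_1,\Omega_2\}=\Omega_3$,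 $\{\Omega_2,\Omega_3\}=\Omega_1$, $\{\Omega_3,\Omega_1\}=\Omega_2$, the Hamiltonian $H=\frac12\left[\frac{\Omega_1^2}{s-1}+\frac{\Omega_2^2}{s}\right]$ (for $s\neq0,1$) gives the system $\frac{d\Omega_i}{ds}=\{\Omega_i,H\}$, that is, $$\frac{d\Omega_1}{ds}=\frac1s\Omega_2\Omega_3,\qquad \frac{d\Omega_2}{ds}=-\frac1{s-1}\Omega_1\Omega_3,\qquad \frac{d\Omega_3}{ds}=\frac1{s(s-1)}\Omega_1\Omega_2 .$$ Let $\mathscr N_1,\mathscr N_2,\mathscr N_3$ be as in 2. There are continuous branches on $\mathfrak H$ of the three square roots below whose product is $$\sqrt{(\mathscr N_2-\mathscr N_1)(\mathscr N_1-\mathscr N_3)}\,\sqrt{(\mathscr N_3-\mathscr N_2)(\mathscr N_2-\mathscr N_1)}\,\sqrt{(\mathscr N_1-\mathscr N_3)(\mathscr N_3-\mathscr N_2)}=(\mathscr N_2-\mathscr N_1)(\mathscr N_1-\mathscr N_3)(\mathscr N_3-\mathscr N_2),$$ and for all such branches the functions $$\Omega_1=\frac{\mathscr N_1}{2\sqrt{(\mathscr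 N_2-\mathscr N_1)(\mathscr N_1-\mathscr N_3)}},\quad \Omega_2=\frac{\mathscr N_2}{2\sqrt{(\mathscr N_3-\mathscr N_2)(\mathscr N_2-\mathscr N_1)}},\quad \Omega_3=\frac{\mathscr N_3}{2\sqrt{(\mathscr N_1-\mathscr N_3)(\mathscr N_3-\mathscr N_2)}}$$ of $t_3\in\mathfrak H$ solve this system in the variable $$s=\frac{\mathscr N_3(t_3)-\mathscr N_1(t_3)}{\mathscr N_2(t_3)-\mathscr N_1(t_3)} .$$ Here near every point of $\mathfrak H$ the function $s$ is a holomorphic local coordinate with values different from $0$ and $1$, and $\Omega_1,\Omega_2,\Omega_3$ are regarded as functions of $s$. -/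

import Mathlib

noncomputable section

namespace FrobeniusChazy

open UpperHalfPlane

/-! ### Frobenius manifolds given by a potential in flat coordinates

Points and tangent vectors of an open set `M ⊆ ℂⁿ` are written in the flat coordinates; the
coordinate vector field number `0` is the unit. -/

section Frobenius

variable {n : ℕ} [NeZero n]

/-- The `i`-th partial derivative `∂f/∂tᵢ`. -/
def pderiv (i : Fin n) (f : (Fin n → ℂ) → ℂ) (t : Fin n → ℂ) : ℂ :=
  fderiv ℂ f t (Pi.single i 1)

/-- The third derivatives `C_{ijk} = ∂ᵢ∂ⱼ∂ₖF`. -/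
def C₃ (F : (Fin n → ℂ) → ℂ) (t : Fin n → ℂ) (i j k : Fin n) : ℂ :=
  pderiv i (pderiv j (pderiv k F)) t

/-- The Gram matrix `η_{ij} = C_{1ij}` of the flat metric (the first index, written `1` in the
literature, is `0 : Fin n`). -/
def eta (F : (Fin n → ℂ) → ℂ) (t : Fin n → ℂ) : Matrix (Fin n) (Fin n) ℂ :=
  Matrix.of fun i j => C₃ F t 0 i j

/-- The metric `η = ∑ η_{ij} dtᵢ dtⱼ`, as a bilinear form on tangent vectors at `t`. -/
def metric (F : (Fin n → ℂ) → ℂ) (t : Fin n → ℂ) (v w : Fin n → ℂ) : ℂ :=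
  ∑ i, ∑ j, eta F t i j * v i * w j

/-- The structure constants `C_{ij}^k = ∑ₗ η^{kl} C_{lij}`, where `(η^{kl}) = (η_{kl})⁻¹`. -/
def structConst (F : (Fin n → ℂ) → ℂ) (t : Fin n → ℂ) (i j k : Fin n) : ℂ :=
  ∑ l, (eta F t)⁻¹ k l * C₃ F t l i j

/-- The multiplication of tangent vectors at `t`, with `∂ᵢ ∘ ∂ⱼ = ∑ₖ C_{ij}^k ∂ₖ`. -/
def mul (F : (Fin n → ℂ) → ℂ) (t : Fin n → ℂ) (v w : Fin n → ℂ) : Fin n → ℂ :=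
  fun k => ∑ i, ∑ j, v i * w j * structConst F t i j k

/-- The potential `F` and the Euler vector field `E` endow the open set `M ⊆ ℂⁿ` with the
structure of a (conformal, holomorphic) Frobenius manifold of charge `d` having the standard
coordinates as flat coordinates: the WDVV equations (constancy and nondegeneracy of `η`,
commutative associative algebras with unit `∂₀` on the tangent spaces) together with
quasihomogeneity (`E` is affine in the flat coordinates, `[∂₀, E] = ∂₀`, and
`E(F) = (3 - d) F` up to a polynomial of degree at most two). -/
structure IsFrobeniusManifold (M : Set (Fin n → ℂ)) (F : (Fin n → ℂ) → ℂ)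
    (E : (Fin n → ℂ) → (Fin n → ℂ)) (d : ℂ) : Prop where
  isOpen : IsOpen M
  holomorphic : DifferentiableOn ℂ F M
  eta_const : ∃ η : Matrix (Fin n) (Fin n) ℂ, η.det ≠ 0 ∧ ∀ t ∈ M, eta F t = η
  mul_comm : ∀ t ∈ M, ∀ v w, mul F t v w = mul F t w v
  mul_assoc : ∀ t ∈ M, ∀ v w x, mul F t (mul F t v w) x = mul F t v (mul F t w x)
  one_mul : ∀ t ∈ M, ∀ v, mul F t (Pi.single 0 1) v = v
  euler_affine : ∃ (A : Matrix (Fin n) (Fin n) ℂ) (r : Fin n → ℂ),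
    A.mulVec (Pi.single 0 1) = Pi.single 0 1 ∧ ∀ t ∈ M, E t = A.mulVec t + r
  quasihomogeneous : ∃ Q : MvPolynomial (Fin n) ℂ, Q.totalDegree ≤ 2 ∧
    ∀ t ∈ M, ∑ i, E t i * pderiv i F t = (3 - d) * F t + MvPolynomial.eval t Q

/-- `u = (u₁, …, uₙ)` are canonical coordinates near the point `p` of the Frobenius manifold
`(M, F, E)`: they restrict to a holomorphic coordinate system `φ` on a neighbourhood of `p` in
`M` whose coordinate vector fields `∂/∂uᵢ` are the orthogonal idempotents,
`∂/∂uᵢ ∘ ∂/∂uⱼ = δᵢⱼ ∂/∂uᵢ`, the additive constants of the `uᵢ` being normalised, as usual, by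
`E = ∑ uᵢ ∂/∂uᵢ`.  The vector field `∂/∂uᵢ` at `t` is the `i`-th column of the derivative of
`φ⁻¹` at `φ t`. -/
def IsCanonicalCoordinatesAt (M : Set (Fin n → ℂ)) (F : (Fin n → ℂ) → ℂ)
    (E : (Fin n → ℂ) → (Fin n → ℂ)) (u : (Fin n → ℂ) → (Fin n → ℂ)) (p : Fin n → ℂ) : Prop :=
  ∃ φ : OpenPartialHomeomorph (Fin n → ℂ) (Fin n → ℂ),
    p ∈ φ.source ∧ φ.source ⊆ M ∧ Set.EqOn φ u φ.source ∧
    DifferentiableOn ℂ φ φ.source ∧ DifferentiableOn ℂ φ.symm φ.target ∧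
    ∀ t ∈ φ.source,
      let del : Fin n → (Fin n → ℂ) := fun i => fderiv ℂ φ.symm (φ t) (Pi.single i 1)
      (∀ i j, mul F t (del i) (del j) = if i = j then del i else 0) ∧
      E t = ∑ i, u t i • del i

end Frobenius

/-! ### The Frobenius manifold attached to `E₂` -/

/-- `γ = (π i / 3) E₂` on the upper half plane, as a function of a complex variable (only its
values on the open set `Im τ > 0` matter). -/
def γ (τ : ℂ) : ℂ := (Real.pi : ℂ) * Complex.I / 3 * EisensteinSeries.E2 (ofComplex τ)

/-- The potential `F = ½ t₁² t₃ + ½ t₁ t₂² - (t₂⁴ / 16) γ(t₃)`; the coordinates `t₁, t₂, t₃` are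
`t 0, t 1, t 2`. -/
def potential (t : Fin 3 → ℂ) : ℂ :=
  1 / 2 * t 0 ^ 2 * t 2 + 1 / 2 * t 0 * t 1 ^ 2 - t 1 ^ 4 / 16 * γ (t 2)

/-- The Euler vector field `t₁ ∂₁ + ½ t₂ ∂₂`. -/
def euler (t : Fin 3 → ℂ) : Fin 3 → ℂ := ![t 0, 1 / 2 * t 1, 0]

/-- `ℂ² × ℍ`. -/
def domain : Set (Fin 3 → ℂ) := {t | 0 < (t 2).im}

/-- `N₁, N₂, N₃` (here `N 0, N 1, N 2`) are the three roots, counted with multiplicity and labelled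
continuously over the upper half plane, of the cubic
`X³ + (3/2) γ X² + (3/2) γ' X + (1/4) γ''`. -/
structure IsRootTriple (N : Fin 3 → ℂ → ℂ) : Prop where
  continuousOn : ∀ i, ContinuousOn (N i) upperHalfPlaneSet
  factor : ∀ τ ∈ upperHalfPlaneSet, ∀ x : ℂ,
    x ^ 3 + 3 / 2 * γ τ * x ^ 2 + 3 / 2 * deriv γ τ * x + 1 / 4 * deriv (deriv γ) τ =
      (x - N 0 τ) * (x - N 1 τ) * (x - N 2 τ)

/-- The functions `uᵢ = t₁ + ½ t₂² Nᵢ(t₃)`. -/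
def canonicalCoord (N : Fin 3 → ℂ → ℂ) (t : Fin 3 → ℂ) : Fin 3 → ℂ :=
  fun i => t 0 + 1 / 2 * t 1 ^ 2 * N i (t 2)

/-! ### The Poisson system -/

/-- The standard (rotation algebra) Lie-Poisson bracket on `ℂ³`, for which
`{Ω₁, Ω₂} = Ω₃`, `{Ω₂, Ω₃} = Ω₁`, `{Ω₃, Ω₁} = Ω₂`. -/
def poissonBracket (f g : (Fin 3 → ℂ) → ℂ) (x : Fin 3 → ℂ) : ℂ :=
  x 2 * (pderiv 0 f x * pderiv 1 g x - pderiv 1 f x * pderiv 0 g x) +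
  x 0 * (pderiv 1 f x * pderiv 2 g x - pderiv 2 f x * pderiv 1 g x) +
  x 1 * (pderiv 2 f x * pderiv 0 g x - pderiv 0 f x * pderiv 2 g x)

/-- The Hamiltonian `H = ½ [Ω₁² / (s - 1) + Ω₂² / s]`, depending on the "time" `s`. -/
def hamiltonian (s : ℂ) (x : Fin 3 → ℂ) : ℂ :=
  1 / 2 * (x 0 ^ 2 / (s - 1) + x 1 ^ 2 / s)

/-- The vector field of the (time dependent) system
`dΩ₁/ds = Ω₂Ω₃/s`, `dΩ₂/ds = -Ω₁Ω₃/(s-1)`, `dΩ₃/ds = Ω₁Ω₂/(s(s-1))`. -/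
def poissonField (s : ℂ) (x : Fin 3 → ℂ) : Fin 3 → ℂ :=
  ![1 / s * (x 1 * x 2), -(1 / (s - 1)) * (x 0 * x 2), 1 / (s * (s - 1)) * (x 0 * x 1)]

/-- `s = (N₃ - N₁) / (N₂ - N₁)`. -/
def sVar (N : Fin 3 → ℂ → ℂ) (τ : ℂ) : ℂ := (N 2 τ - N 0 τ) / (N 1 τ - N 0 τ)

/-- `R₁, R₂, R₃` (here `R 0, R 1, R 2`) are continuous branches over the upper half plane of
`√((N₂-N₁)(N₁-N₃))`, `√((N₃-N₂)(N₂-N₁))`, `√((N₁-N₃)(N₃-N₂))`, with signs matched by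
`R₁R₂R₃ = (N₂-N₁)(N₁-N₃)(N₃-N₂)`. (Squaring shows that the two sides agree up to sign.) -/
structure IsSqrtTriple (N R : Fin 3 → ℂ → ℂ) : Prop where
  continuousOn : ∀ i, ContinuousOn (R i) upperHalfPlaneSet
  sq_zero : ∀ τ ∈ upperHalfPlaneSet, R 0 τ ^ 2 = (N 1 τ - N 0 τ) * (N 0 τ - N 2 τ)
  sq_one : ∀ τ ∈ upperHalfPlaneSet, R 1 τ ^ 2 = (N 2 τ - N 1 τ) * (N 1 τ - N 0 τ)
  sq_two : ∀ τ ∈ upperHalfPlaneSet, R 2 τ ^ 2 = (N 0 τ - N 2 τ) * (N 2 τ - N 1 τ)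
  prod : ∀ τ ∈ upperHalfPlaneSet,
    R 0 τ * R 1 τ * R 2 τ = (N 1 τ - N 0 τ) * (N 0 τ - N 2 τ) * (N 2 τ - N 1 τ)

/-- `Ωᵢ = Nᵢ / (2 Rᵢ)`. -/
def Ω (N R : Fin 3 → ℂ → ℂ) (τ : ℂ) : Fin 3 → ℂ := fun i => N i τ / (2 * R i τ)

/-- Near `τ₀` the function `s` is a holomorphic coordinate with values different from `0` and `1`,
and `X`, regarded as a function of `s`, satisfies `dX/ds = V(s, X)`. -/
def SolvesInVariableAt (s : ℂ → ℂ) (V : ℂ → (Fin 3 → ℂ) → (Fin 3 → ℂ)) (X : ℂ → Fin 3 → ℂ)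
    (τ₀ : ℂ) : Prop :=
  ∃ φ : OpenPartialHomeomorph ℂ ℂ,
    τ₀ ∈ φ.source ∧ φ.source ⊆ upperHalfPlaneSet ∧ Set.EqOn φ s φ.source ∧
    DifferentiableOn ℂ φ φ.source ∧ DifferentiableOn ℂ φ.symm φ.target ∧
    ∀ z ∈ φ.target, z ≠ 0 ∧ z ≠ 1 ∧
      HasDerivAt (fun w => X (φ.symm w)) (V z (X (φ.symm z))) z

end FrobeniusChazy

end

/-!
The functions `E₂`, `E₄`, `E₆` satisfy Ramanujan's differential equations: each difference of the
two sides is modular of level one and weight less than `12` and vanishes at `i∞`, hence is zero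
(`ramanujan_E2`, `ramanujan_E4`, `ramanujan_E6`). They express `γ'` and `γ''` as polynomials in the
three Eisenstein series, and two consequences carry the rest of the argument.

* Chazy's equation `γ''' = 6 γ γ'' - 9 γ'²` (`hasDerivAt_deriv_deriv_γ`). It is the only condition
  that associativity imposes on a potential of the given shape
  (`isFrobeniusManifold_potential`).
* The discriminant of the cubic is a constant multiple of the modular discriminant `Δ`, which has no
  zeros (`depressed_discr_ne_zero`). Hence the roots are distinct, and since the upper half plane is
  simply connected they can be followed continuously along the covering of the space of cubics by
  the space of cubics with a marked root (`exists_isRootTriple`).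

Differentiating the cubic along a root `N` and using Chazy's equation gives the Riccati equation
`N' = 2N² + 3γN + (3/2)γ'` (`IsRootTriple.hasDerivAt`), which in terms of all three roots is the
Halphen system `N₁' = N₂N₃ - N₁(N₂ + N₃)` and its cyclic permutations.

By the Riccati equation and the cubic, the differentials `duᵢ` of `uᵢ = t₁ + ½ t₂² Nᵢ(t₃)` are
characters of the algebras on the tangent spaces (`IsRootTriple.canonicalDiff_mul`), and
`duᵢ(E) = uᵢ`. For `t₂ ≠ 0` they are independent because the roots are distinct, so the `uᵢ` are
canonical coordinates. Conversely, an idempotent field `∂/∂vᵢ` of another system of canonical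
coordinates is sent to `1` by some `duⱼ` that kills the other `∂/∂vₖ`; applying `duⱼ` to the Euler
field gives `vᵢ = uⱼ` (`IsRootTriple.exists_canonicalDiff_eq_one`).

The Halphen system also gives `ds/dt₃ = -2 (N₂ - N₃) s ≠ 0` and `dΩ₁/dt₃ = N₂N₃ / (2R₁)`, where `Rᵢ`
denotes the chosen square root in the denominator of `Ωᵢ`, and cyclically. The sign condition on
`R₁R₂R₃` amounts to `R₂R₃ = (N₃ - N₂) R₁` and its cyclic permutations, which turn these
derivatives into the Poisson system (`IsSqrtTriple.hasDerivAt_Ω`).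
-/

open UpperHalfPlane hiding I
open Complex Filter Topology EisensteinSeries ModularForm Derivative
open scoped Real Manifold MatrixGroups ModularForm

noncomputable section

namespace FrobeniusChazy

/-! ### Ramanujan's differential equations -/

/-- At the cusp `i∞` a `q`-series tends to its constant term. -/
lemma tendsto_atImInfty_of_hasSum_qExpansion {f : ℍ → ℂ} {c : ℕ → ℂ}
    (hf : ∀ τ : ℍ, HasSum (fun m ↦ c m • Function.Periodic.qParam 1 τ ^ m) (f τ)) :
    Tendsto f atImInfty (𝓝 (c 0)) := by
  set q : ℍ → ℂ := fun τ ↦ Function.Periodic.qParam 1 τ with hq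
  have hq0 : ∀ τ, q τ ≠ 0 := fun τ ↦ Function.Periodic.qParam_ne_zero _
  -- `g = (f - c 0) / q` is again given by a power series in `q`, hence bounded.
  have hg : ∀ τ : ℍ, HasSum (fun m ↦ c (m + 1) • Function.Periodic.qParam 1 τ ^ m)
      ((f τ - c 0) / q τ) := by
    intro τ
    have h1 := (hasSum_nat_add_iff' 1).mpr (hf τ)
    simp only [Finset.range_one, Finset.sum_singleton, pow_zero, smul_eq_mul, mul_one] at h1
    have h2 : (fun m ↦ c (m + 1) • Function.Periodic.qParam 1 (τ : ℂ) ^ m) =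
        fun m ↦ c (m + 1) * Function.Periodic.qParam 1 (τ : ℂ) ^ (m + 1) / q τ := by
      funext m
      rw [eq_div_iff (hq0 τ), smul_eq_mul, pow_succ, mul_assoc]
    rw [h2]
    exact h1.div_const (q τ)
  have hb := isBoundedAtImInfty_of_hasSum_qExpansion one_pos hg
  have h0 : Tendsto (fun τ ↦ q τ * ((f τ - c 0) / q τ)) atImInfty (𝓝 0) := by
    have : ((fun τ ↦ q τ * ((f τ - c 0) / q τ))) =O[atImInfty] (fun τ ↦ q τ * (1 : ℂ)) :=
      (Asymptotics.isBigO_refl q _).mul (hb.trans (Asymptotics.isBigO_of_le _ (by simp)))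
    refine this.trans_tendsto ?_
    simpa using qParam_tendsto_atImInfty one_pos
  have := h0.add_const (c 0)
  simp only [zero_add] at this
  refine this.congr fun τ ↦ ?_
  field_simp [hq0 τ]
  ring

lemma E2_tendsto_one : Tendsto E2 atImInfty (𝓝 1) := by
  have h := tendsto_atImInfty_of_hasSum_qExpansion (f := E2)
    (c := fun m ↦ if m = 0 then 1 else -24 * ArithmeticFunction.sigma 1 m) fun τ ↦ by
      simpa only [Function.Periodic.qParam, ofReal_one, div_one] using hasSum_qExpansion_E2 (z := τ)
  rwa [if_pos rfl] at h

lemma E_tendsto_one {k : ℕ} (hk : 3 ≤ k) (hk2 : Even k) : Tendsto (E hk) atImInfty (𝓝 1) := by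
  rw [← E_qExpansion_coeff_zero hk hk2]
  exact tendsto_atImInfty_of_hasSum_qExpansion fun τ ↦
    ModularForm.hasSum_qExpansion (E hk) one_pos one_mem_strictPeriods_SL τ

/-- Cauchy's estimate on the disc of radius about `Im z / 2` around `z`. -/
lemma normalizedDeriv_isZeroAtImInfty {f : ℍ → ℂ} (hf : MDiff f) (hb : IsBoundedAtImInfty f) :
    Tendsto (normalizedDerivOfComplex f) atImInfty (𝓝 0) := by
  obtain ⟨M, A, hM⟩ := isBoundedAtImInfty_iff.mp hb
  rw [UpperHalfPlane.mdifferentiable_iff] at hf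
  set B := max A 0
  have hAB : A ≤ B := le_max_left _ _
  have hB : 0 ≤ B := le_max_right _ _
  have key : ∀ z : ℍ, B < z.im → ‖deriv (f ∘ ofComplex) z‖ ≤ M / ((z.im - B) / 2) := by
    intro z hz
    have hr : 0 < (z.im - B) / 2 := by linarith
    have him : ∀ w ∈ Metric.closedBall (z : ℂ) ((z.im - B) / 2), 0 < w.im ∧ A ≤ w.im := by
      intro w hw
      rw [Metric.mem_closedBall, dist_eq_norm] at hw
      have h1 := (abs_le.mp ((Complex.abs_im_le_norm (w - z)).trans hw)).1
      rw [Complex.sub_im, UpperHalfPlane.coe_im] at h1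
      constructor <;> linarith
    refine Complex.norm_deriv_le_of_forall_mem_sphere_norm_le hr ?_ ?_
    · refine DifferentiableOn.diffContOnCl (hf.mono ?_)
      exact Metric.closure_ball_subset_closedBall.trans fun w hw ↦ (him w hw).1
    · intro w hw
      have := him w (Metric.sphere_subset_closedBall hw)
      have h := hM (ofComplex w) (by simpa [ofComplex_apply_of_im_pos this.1] using! this.2)
      simpa using h
  have hlim : Tendsto (fun z : ℍ ↦ M / ((z.im - B) / 2)) atImInfty (𝓝 0) := by
    refine Tendsto.div_atTop tendsto_const_nhds ?_
    have him : Tendsto (fun z : ℍ ↦ z.im) atImInfty atTop := tendsto_comap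
    exact (tendsto_atTop_add_const_right atImInfty (-B) him).atTop_div_const two_pos
  have h0 : Tendsto (fun z : ℍ ↦ deriv (f ∘ ofComplex) z) atImInfty (𝓝 0) := by
    refine squeeze_zero_norm' ?_ hlim
    filter_upwards [(atImInfty_mem _).mpr ⟨B + 1, fun z hz ↦ hz⟩] with z hz
    exact key z (by linarith [show B + 1 ≤ z.im from hz])
  simpa only [mul_zero] using! h0.const_mul ((2 * π * I : ℂ)⁻¹)

/-- There are no level one cusp forms of weight less than `12`; an invariant holomorphic function
that tends to `0` at `i∞` is a cusp form, as all cusps are equivalent. -/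
lemma eq_zero_of_slash_invariant {f : ℍ → ℂ} {k : ℤ} (hk : k < 12) (hf : MDiff f)
    (hslash : ∀ g : SL(2, ℤ), f ∣[k] g = f) (h0 : Tendsto f atImInfty (𝓝 0)) : f = 0 := by
  let F : CuspForm 𝒮ℒ k :=
    { toFun := f
      slash_action_eq' := fun A ⟨g, hg⟩ ↦ hg ▸ hslash g
      holo' := hf
      zero_at_cusps' := fun hc ↦ by
        rw [Subgroup.IsArithmetic.isCusp_iff_isCusp_SL2Z] at hc
        rw [OnePoint.isZeroAt_iff_forall_SL2Z hc]
        intro g _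
        rw [hslash]
        exact h0 }
  have : F = 0 := rank_zero_iff_forall_zero.mp (CuspForm.rank_eq_zero_of_weight_lt_twelve hk) F
  exact congrArg DFunLike.coe this

lemma slash_SL2Z_eq {k : ℤ} (f : ModularForm 𝒮ℒ k) (g : SL(2, ℤ)) : ⇑f ∣[k] g = ⇑f :=
  f.slash_action_eq' _ ⟨g, rfl⟩

/-- The anomaly `D2 g = 2πi c / (c z + d)` of `E₂` satisfies a Riccati equation: its normalized
derivative is `-(c / (c z + d))²`, a multiple of its square. -/
lemma normalizedDeriv_D2 (g : SL(2, ℤ)) :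
    normalizedDerivOfComplex (D2 g) = fun z : ℍ ↦ -((g 1 0 : ℂ) / denom g z) ^ 2 := by
  ext z
  have h1 := (hasDerivAt_denom_zpow (g : GL (Fin 2) ℝ) (-1) z).const_mul (2 * π * I * g 1 0)
  have h2 : (D2 g ∘ ofComplex) =ᶠ[𝓝 (z : ℂ)]
      fun w ↦ 2 * π * I * g 1 0 * denom (g : GL (Fin 2) ℝ) w ^ (-1 : ℤ) := by
    filter_upwards [isOpen_upperHalfPlaneSet.mem_nhds z.im_pos] with w hw
    rw [Function.comp_apply, D2, ofComplex_apply_of_im_pos hw, zpow_neg_one]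
    rfl
  have hd := denom_ne_zero (g : GL (Fin 2) ℝ) z
  have hpi := two_pi_I_ne_zero
  rw [normalizedDerivOfComplex, h2.deriv_eq, h1.deriv]
  simp only [Int.cast_neg, Int.cast_one, show (-1 - 1 : ℤ) = -2 by norm_num, zpow_neg]
  have : ((g : GL (Fin 2) ℝ) 1 0 : ℂ) = (g 1 0 : ℂ) := by simp
  rw [this]
  field_simp

/-- With `D = (2πi)⁻¹ d/dz`, the quadratic anomalies of `D E₂` and `E₂² / 12` cancel, so their
difference is modular of weight `4`. -/
lemma slash_E2_weight_four (g : SL(2, ℤ)) :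
    (normalizedDerivOfComplex E2 - (12⁻¹ : ℂ) • (E2 * E2)) ∣[(4 : ℤ)] g =
      normalizedDerivOfComplex E2 - (12⁻¹ : ℂ) • (E2 * E2) := by
  have hE := E2_slash_action g
  have hG : normalizedDerivOfComplex E2 - (12⁻¹ : ℂ) • (E2 * E2) =
      serreDerivative ((2 : ℤ) : ℂ) E2 + (12⁻¹ : ℂ) • (E2 * E2) := by
    ext z
    simp only [Pi.sub_apply, Pi.add_apply, Pi.smul_apply, Pi.mul_apply, smul_eq_mul,
      serreDerivative_apply]
    push_cast
    ring
  have hD2 : MDiff (D2 g) := by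
    have h : D2 g = (2 * riemannZeta 2) • (E2 - E2 ∣[(2 : ℤ)] g) := by
      rw [hE, sub_sub_cancel, smul_smul, riemannZeta_two, mul_one_div_cancel, one_smul]
      exact mul_ne_zero two_ne_zero
        (div_ne_zero (pow_ne_zero _ (ofReal_ne_zero.mpr Real.pi_ne_zero)) (by norm_num))
    rw [h]
    exact (E2_mdifferentiable.sub (E2_mdifferentiable.slash 2 _)).const_smul _
  have hmul : (E2 * E2) ∣[(4 : ℤ)] g = (E2 ∣[(2 : ℤ)] g) * (E2 ∣[(2 : ℤ)] g) :=
    mul_slash_SL2 2 2 g E2 E2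
  have hser := serreDerivative_slash_equivariant (k := 2) (γ := g) E2_mdifferentiable
  rw [show (2 + 2 : ℤ) = 4 by norm_num] at hser
  rw [hG, SlashAction.add_slash, SL_smul_slash, hser, hmul, hE]
  ext z
  simp only [Pi.sub_apply, Pi.add_apply, Pi.smul_apply, Pi.mul_apply, smul_eq_mul,
    serreDerivative_apply]
  rw [normalizedDerivOfComplex_sub _ _ E2_mdifferentiable (hD2.const_smul _),
    normalizedDerivOfComplex_smul _ _ hD2, normalizedDeriv_D2]
  simp only [Pi.sub_apply, Pi.smul_apply, smul_eq_mul, D2, riemannZeta_two]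
  have hpi : (π : ℂ) ≠ 0 := ofReal_ne_zero.mpr Real.pi_ne_zero
  set u : ℂ := (g 1 0 : ℂ)
  have hd := denom_ne_zero (g : GL (Fin 2) ℝ) z
  push_cast
  field_simp
  ring_nf
  simp only [I_sq]
  ring

theorem ramanujan_E2 (z : ℍ) :
    normalizedDerivOfComplex E2 z = (E2 z ^ 2 - E₄ z) / 12 := by
  have h := eq_zero_of_slash_invariant
    (f := normalizedDerivOfComplex E2 - (12⁻¹ : ℂ) • (E2 * E2) + (12⁻¹ : ℂ) • ⇑E₄) (k := 4)
    (by norm_num) ?_ ?_ ?_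
  · have := congrFun h z
    simp only [Pi.add_apply, Pi.sub_apply, Pi.smul_apply, Pi.mul_apply, smul_eq_mul,
      Pi.zero_apply] at this
    linear_combination this
  · exact ((normalizedDerivOfComplex_mdifferentiable E2_mdifferentiable).sub
      ((E2_mdifferentiable.mul E2_mdifferentiable).const_smul _)).add (E₄.holo'.const_smul _)
  · intro g
    rw [SlashAction.add_slash, slash_E2_weight_four, SL_smul_slash, slash_SL2Z_eq]
  · have h4 := E_tendsto_one (k := 4) (by norm_num) (by decide)
    have hD := normalizedDeriv_isZeroAtImInfty E2_mdifferentiable isBoundedAtImInfty_E2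
    have := (hD.sub ((E2_tendsto_one.mul E2_tendsto_one).const_mul (12⁻¹ : ℂ))).add
      (h4.const_mul (12⁻¹ : ℂ))
    simpa using! this

/-- For modular forms `f`, `g` of weights `k`, `k + 2` with constant term `1`, the Serre derivative
`D f - (k/12) E₂ f` plus `(k/12) g` is modular of weight `k + 2 < 12` and vanishes at `i∞`. -/
lemma normalizedDeriv_eq_of_tendsto_one {k : ℕ} (f : ModularForm 𝒮ℒ k)
    (g : ModularForm 𝒮ℒ (k + 2)) (hk : k < 10)
    (hf : Tendsto f atImInfty (𝓝 1)) (hg : Tendsto g atImInfty (𝓝 1)) (z : ℍ) :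
    normalizedDerivOfComplex f z = k / 12 * (E2 z * f z - g z) := by
  have h := eq_zero_of_slash_invariant
    (f := serreDerivative ((k : ℤ) : ℂ) f + (k / 12 : ℂ) • ⇑g) (k := k + 2)
    (by omega) ?_ ?_ ?_
  · have := congrFun h z
    simp only [Pi.add_apply, serreDerivative_apply, Pi.smul_apply, smul_eq_mul,
      Pi.zero_apply, Int.cast_natCast] at this
    linear_combination this
  · exact (serreDerivative_mdifferentiable _ f.holo').add (g.holo'.const_smul _)
  · intro A
    have hser : serreDerivative ((k : ℤ) : ℂ) f ∣[(k + 2 : ℤ)] A =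
        serreDerivative ((k : ℤ) : ℂ) f :=
      serreDerivative_slash_invariant f.holo' (slash_SL2Z_eq f A)
    rw [SlashAction.add_slash, hser, SL_smul_slash, slash_SL2Z_eq]
  · have hD : Tendsto (normalizedDerivOfComplex ⇑f) atImInfty (𝓝 0) :=
      normalizedDeriv_isZeroAtImInfty f.holo' (ModularFormClass.bdd_at_infty f)
    have := (hD.sub ((E2_tendsto_one.mul hf).const_mul (k / 12 : ℂ))).add
      (hg.const_mul (k / 12 : ℂ))
    simp only [mul_one, zero_sub, neg_add_cancel] at this
    refine this.congr fun z ↦ ?_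
    simp only [Pi.add_apply, serreDerivative_apply, Pi.smul_apply, smul_eq_mul, Int.cast_natCast]
    ring

theorem ramanujan_E4 (z : ℍ) :
    normalizedDerivOfComplex E₄ z = (E2 z * E₄ z - E₆ z) / 3 := by
  have := normalizedDeriv_eq_of_tendsto_one (k := 4) E₄ E₆ (by norm_num)
    (E_tendsto_one _ (by decide)) (E_tendsto_one _ (by decide)) z
  push_cast at this
  linear_combination this

theorem ramanujan_E6 (z : ℍ) :
    normalizedDerivOfComplex E₆ z = (E2 z * E₆ z - E₄ z ^ 2) / 2 := by
  have h4 := E_tendsto_one (k := 4) (by norm_num) (by decide)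
  have := normalizedDeriv_eq_of_tendsto_one (k := 6) E₆ (E₄.mul E₄) (by norm_num)
    (E_tendsto_one _ (by decide)) (by simpa using! h4.mul h4) z
  simp only [coe_mul, Pi.mul_apply] at this
  push_cast at this
  linear_combination this

/-! ### Chazy's equation and the discriminant of the cubic -/

lemma hasDerivAt_comp_ofComplex {F : ℍ → ℂ} (hF : MDiff F) {τ : ℂ} (hτ : τ ∈ upperHalfPlaneSet) :
    HasDerivAt (F ∘ ofComplex) (2 * π * I * normalizedDerivOfComplex F (ofComplex τ)) τ := by
  have h := (UpperHalfPlane.mdifferentiableAt_iff.mp (hF ⟨τ, hτ⟩)).hasDerivAt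
  have hval : 2 * π * I * normalizedDerivOfComplex F ⟨τ, hτ⟩ = deriv (F ∘ ofComplex) τ :=
    mul_inv_cancel_left₀ two_pi_I_ne_zero _
  rw [ofComplex_apply_of_im_pos hτ, hval]
  exact h

lemma hasDerivAt_E2 {τ : ℂ} (hτ : τ ∈ upperHalfPlaneSet) :
    HasDerivAt (fun z ↦ E2 (ofComplex z))
      (2 * π * I * ((E2 (ofComplex τ) ^ 2 - E₄ (ofComplex τ)) / 12)) τ :=
  ramanujan_E2 (ofComplex τ) ▸ hasDerivAt_comp_ofComplex E2_mdifferentiable hτ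

lemma hasDerivAt_E4 {τ : ℂ} (hτ : τ ∈ upperHalfPlaneSet) :
    HasDerivAt (fun z ↦ E₄ (ofComplex z))
      (2 * π * I * ((E2 (ofComplex τ) * E₄ (ofComplex τ) - E₆ (ofComplex τ)) / 3)) τ :=
  ramanujan_E4 (ofComplex τ) ▸ hasDerivAt_comp_ofComplex E₄.holo' hτ

lemma hasDerivAt_E6 {τ : ℂ} (hτ : τ ∈ upperHalfPlaneSet) :
    HasDerivAt (fun z ↦ E₆ (ofComplex z))
      (2 * π * I * ((E2 (ofComplex τ) * E₆ (ofComplex τ) - E₄ (ofComplex τ) ^ 2) / 2)) τ :=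
  ramanujan_E6 (ofComplex τ) ▸ hasDerivAt_comp_ofComplex E₆.holo' hτ

lemma hasDerivAt_γ_E {τ : ℂ} (hτ : τ ∈ upperHalfPlaneSet) :
    HasDerivAt γ ((π * I / 3) ^ 2 / 2 * (E2 (ofComplex τ) ^ 2 - E₄ (ofComplex τ))) τ :=
  ((hasDerivAt_E2 hτ).const_mul (π * I / 3)).congr_deriv (by ring)

lemma deriv_γ_eq {τ : ℂ} (hτ : τ ∈ upperHalfPlaneSet) :
    deriv γ τ = (π * I / 3) ^ 2 / 2 * (E2 (ofComplex τ) ^ 2 - E₄ (ofComplex τ)) :=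
  (hasDerivAt_γ_E hτ).deriv

lemma eventually_mem_upperHalfPlaneSet {τ : ℂ} (hτ : τ ∈ upperHalfPlaneSet) :
    ∀ᶠ z in 𝓝 τ, z ∈ upperHalfPlaneSet :=
  isOpen_upperHalfPlaneSet.mem_nhds hτ

lemma hasDerivAt_deriv_γ_E {τ : ℂ} (hτ : τ ∈ upperHalfPlaneSet) :
    HasDerivAt (deriv γ) ((π * I / 3) ^ 3 * (E2 (ofComplex τ) ^ 3 / 2 -
      3 / 2 * E2 (ofComplex τ) * E₄ (ofComplex τ) + E₆ (ofComplex τ))) τ := by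
  have h := (((hasDerivAt_E2 hτ).pow 2).sub (hasDerivAt_E4 hτ)).const_mul ((π * I / 3) ^ 2 / 2)
  refine (h.congr_of_eventuallyEq ?_).congr_deriv ?_
  · filter_upwards [eventually_mem_upperHalfPlaneSet hτ] with z hz using deriv_γ_eq hz
  · push_cast
    ring

lemma deriv_deriv_γ_eq {τ : ℂ} (hτ : τ ∈ upperHalfPlaneSet) :
    deriv (deriv γ) τ = (π * I / 3) ^ 3 * (E2 (ofComplex τ) ^ 3 / 2 -
      3 / 2 * E2 (ofComplex τ) * E₄ (ofComplex τ) + E₆ (ofComplex τ)) :=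
  (hasDerivAt_deriv_γ_E hτ).deriv

lemma hasDerivAt_γ {τ : ℂ} (hτ : τ ∈ upperHalfPlaneSet) : HasDerivAt γ (deriv γ τ) τ :=
  (hasDerivAt_γ_E hτ).differentiableAt.hasDerivAt

lemma hasDerivAt_deriv_γ {τ : ℂ} (hτ : τ ∈ upperHalfPlaneSet) :
    HasDerivAt (deriv γ) (deriv (deriv γ) τ) τ :=
  (hasDerivAt_deriv_γ_E hτ).differentiableAt.hasDerivAt

/-- Chazy's equation `γ''' = 6 γ γ'' - 9 γ'²`. -/
theorem hasDerivAt_deriv_deriv_γ {τ : ℂ} (hτ : τ ∈ upperHalfPlaneSet) :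
    HasDerivAt (deriv (deriv γ)) (6 * γ τ * deriv (deriv γ) τ - 9 * deriv γ τ ^ 2) τ := by
  have h := (((((hasDerivAt_E2 hτ).pow 3).div_const 2).sub
    (((hasDerivAt_E2 hτ).const_mul (3 / 2)).mul (hasDerivAt_E4 hτ))).add
    (hasDerivAt_E6 hτ)).const_mul ((π * I / 3) ^ 3)
  refine (h.congr_of_eventuallyEq ?_).congr_deriv ?_
  · filter_upwards [eventually_mem_upperHalfPlaneSet hτ] with z hz using deriv_deriv_γ_eq hz
  · rw [deriv_γ_eq hτ, deriv_deriv_γ_eq hτ, γ]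
    push_cast
    ring

/-- Substituting `x = y - γ/2` turns the cubic into `y³ + p y + q`; here
`p = -(3/4)(πi/3)² E₄`. -/
def depressedP (τ : ℂ) : ℂ := 3 / 2 * deriv γ τ - 3 / 4 * γ τ ^ 2

/-- The constant coefficient `q = (1/4)(πi/3)³ E₆` of the depressed cubic `y³ + p y + q`. -/
def depressedQ (τ : ℂ) : ℂ := 1 / 4 * (γ τ ^ 3 - 3 * γ τ * deriv γ τ + deriv (deriv γ) τ)

/-- The discriminant of the cubic is a nonzero multiple of `E₄³ - E₆² = 1728 Δ`. -/
theorem depressed_discr_ne_zero {τ : ℂ} (hτ : τ ∈ upperHalfPlaneSet) :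
    4 * depressedP τ ^ 3 + 27 * depressedQ τ ^ 2 ≠ 0 := by
  have hΔ := ModularForm.discriminant_eq_E₄_cube_sub_E₆_sq (ofComplex τ)
  have h : 4 * depressedP τ ^ 3 + 27 * depressedQ τ ^ 2 =
      -(27 / 16) * 1728 * (π * I / 3) ^ 6 * ModularForm.discriminant (ofComplex τ) := by
    rw [hΔ, depressedP, depressedQ, deriv_γ_eq hτ, deriv_deriv_γ_eq hτ, γ]
    ring
  rw [h]
  have hpi : (π : ℂ) ≠ 0 := ofReal_ne_zero.mpr Real.pi_ne_zero
  have := ModularForm.discriminant_ne_zero (ofComplex τ)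
  simp [hpi, this]

/-! ### Charts from the inverse function theorem -/

section Charts

variable {V : Type*} [NormedAddCommGroup V] [NormedSpace ℂ V]

lemma fderiv_fderiv_symm_apply {φ : OpenPartialHomeomorph V V} {x : V} (hx : x ∈ φ.source)
    (hφ : DifferentiableAt ℂ φ x) (hs : DifferentiableAt ℂ φ.symm (φ x)) (v : V) :
    fderiv ℂ φ x (fderiv ℂ φ.symm (φ x) v) = v := by
  have hφ' : DifferentiableAt ℂ φ (φ.symm (φ x)) := by rwa [φ.left_inv hx]
  have h1 := hφ'.hasFDerivAt.comp (φ x) hs.hasFDerivAt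
  have h2 : HasFDerivAt (φ ∘ φ.symm) (ContinuousLinearMap.id ℂ V) (φ x) :=
    (hasFDerivAt_id _).congr_of_eventuallyEq (by
      filter_upwards [φ.open_target.mem_nhds (φ.map_source hx)] with z hz using φ.right_inv hz)
  have h := congrArg (fun T : V →L[ℂ] V ↦ T v) (h1.unique h2)
  simpa only [φ.left_inv hx] using! h

variable [FiniteDimensional ℂ V]

lemma exists_openPartialHomeomorph {f : V → V} {a : V} (hf : ContDiffAt ℂ 1 f a)
    (hinj : Function.Injective (fderiv ℂ f a)) :
    ∃ φ : OpenPartialHomeomorph V V, a ∈ φ.source ∧ f = φ := by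
  have : CompleteSpace V := FiniteDimensional.complete ℂ V
  let e : V ≃L[ℂ] V :=
    (LinearEquiv.ofInjectiveEndo (fderiv ℂ f a : V →ₗ[ℂ] V) hinj).toContinuousLinearEquiv
  have he : HasFDerivAt f (e : V →L[ℂ] V) a := by
    have h := (hf.differentiableAt one_ne_zero).hasFDerivAt
    convert h using 1
    ext v
    rfl
  exact ⟨hf.toOpenPartialHomeomorph f he one_ne_zero,
    hf.mem_toOpenPartialHomeomorph_source he one_ne_zero, rfl⟩

/-- A holomorphic map whose derivative is injective on an open set restricts to a biholomorphic
chart near every point of that set. -/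
lemma exists_holomorphic_chart {f : V → V} {S : Set V} (hS : IsOpen S) (hf : ContDiffOn ℂ 1 f S)
    (hinj : ∀ x ∈ S, Function.Injective (fderiv ℂ f x)) {a : V} (ha : a ∈ S) :
    ∃ φ : OpenPartialHomeomorph V V, a ∈ φ.source ∧ φ.source ⊆ S ∧ f = φ ∧
      DifferentiableOn ℂ φ φ.source ∧ DifferentiableOn ℂ φ.symm φ.target := by
  have hfx : ∀ x ∈ S, ContDiffAt ℂ 1 f x := fun x hx ↦ hf.contDiffAt (hS.mem_nhds hx)
  obtain ⟨ψ, haψ, hψ⟩ := exists_openPartialHomeomorph (hfx a ha) (hinj a ha)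
  have hsrc : (ψ.restrOpen S hS).source ⊆ S := fun x hx ↦ hx.2
  refine ⟨ψ.restrOpen S hS, ⟨haψ, ha⟩, hsrc, hψ, ?_, ?_⟩
  · exact fun x hx ↦ (hψ ▸ (hfx x (hsrc hx)).differentiableAt one_ne_zero :
      DifferentiableAt ℂ ψ x).differentiableWithinAt
  · intro y hy
    set φ := ψ.restrOpen S hS
    have hxS := hsrc (φ.map_target hy)
    let e : V ≃L[ℂ] V := (LinearEquiv.ofInjectiveEndo (fderiv ℂ f (φ.symm y) : V →ₗ[ℂ] V)
      (hinj _ hxS)).toContinuousLinearEquiv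
    have he : HasFDerivAt φ (e : V →L[ℂ] V) (φ.symm y) := by
      have h := ((hfx _ hxS).differentiableAt one_ne_zero).hasFDerivAt
      have h1 : HasFDerivAt f (e : V →L[ℂ] V) (φ.symm y) := by
        convert h using 1
        ext v
        rfl
      rwa [hψ] at h1
    exact (φ.hasFDerivAt_symm hy he).differentiableAt.differentiableWithinAt

end Charts

/-! ### Continuous choice of the roots -/

/-- The map sending `(a, x)` to the depressed cubic `y³ + a y + b`, given by `(a, b)`, that has `x`
as a root. -/
def cubicOfRoot (e : ℂ × ℂ) : ℂ × ℂ := (e.1, -e.2 ^ 3 - e.1 * e.2)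

lemma continuous_cubicOfRoot : Continuous cubicOfRoot := by
  unfold cubicOfRoot
  fun_prop

lemma isProperMap_cubicOfRoot : IsProperMap cubicOfRoot := by
  rw [isProperMap_iff_isCompact_preimage]
  refine ⟨continuous_cubicOfRoot, fun K hK ↦ ?_⟩
  refine Metric.isCompact_of_isClosed_isBounded (hK.isClosed.preimage continuous_cubicOfRoot) ?_
  obtain ⟨M, hM⟩ := hK.isBounded.exists_norm_le
  refine isBounded_iff_forall_norm_le.mpr ⟨2 * M + 2, fun e he ↦ ?_⟩
  have h := hM _ he
  have h1 : ‖e.1‖ ≤ M := (norm_fst_le (cubicOfRoot e)).trans h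
  have h2 : ‖-e.2 ^ 3 - e.1 * e.2‖ ≤ M := (norm_snd_le (cubicOfRoot e)).trans h
  have hM0 : 0 ≤ M := (norm_nonneg _).trans h1
  refine norm_prod_le_iff.mpr ⟨by linarith, ?_⟩
  by_contra! hlt
  have h3 : ‖e.2‖ ^ 3 ≤ M + M * ‖e.2‖ := by
    have : e.2 ^ 3 = -(-e.2 ^ 3 - e.1 * e.2) - e.1 * e.2 := by ring
    calc ‖e.2‖ ^ 3 = ‖e.2 ^ 3‖ := (norm_pow _ _).symm
      _ ≤ ‖-(-e.2 ^ 3 - e.1 * e.2)‖ + ‖e.1 * e.2‖ :=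
        (congrArg norm this).trans_le (norm_sub_le _ _)
      _ ≤ M + M * ‖e.2‖ := by
        rw [norm_neg, norm_mul]
        gcongr
  nlinarith [sq_nonneg ‖e.2‖, mul_pos (show 0 < ‖e.2‖ by linarith) (show 0 < ‖e.2‖ by linarith)]

/-- Over the cubics with distinct roots, `cubicOfRoot` is a covering: it is a local homeomorphism
there, because a simple root depends holomorphically on the coefficients, and it is proper. -/
lemma isCoveringMapOn_cubicOfRoot :
    IsCoveringMapOn cubicOfRoot {c | 4 * c.1 ^ 3 + 27 * c.2 ^ 2 ≠ 0} := by
  have hloc : IsLocalHomeomorphOn cubicOfRoot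
      (cubicOfRoot ⁻¹' {c | 4 * c.1 ^ 3 + 27 * c.2 ^ 2 ≠ 0}) := by
    intro e he
    have hd : -(3 * e.2 ^ 2 + e.1) ≠ 0 := by
      intro h0
      refine he ?_
      simp only [cubicOfRoot]
      have : e.1 = -3 * e.2 ^ 2 := by linear_combination -h0
      rw [this]
      ring
    have hC : ContDiff ℂ 1 cubicOfRoot := by
      unfold cubicOfRoot
      fun_prop
    have hder : ∀ v : ℂ × ℂ, fderiv ℂ cubicOfRoot e v =
        (v.1, -(3 * e.2 ^ 2 + e.1) * v.2 - e.2 * v.1) := by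
      intro v
      have h : HasFDerivAt cubicOfRoot ((ContinuousLinearMap.fst ℂ ℂ ℂ).prod
          (-((3 • e.2 ^ (3 - 1)) • ContinuousLinearMap.snd ℂ ℂ ℂ) -
            (e.1 • ContinuousLinearMap.snd ℂ ℂ ℂ + e.2 • ContinuousLinearMap.fst ℂ ℂ ℂ))) e :=
        hasFDerivAt_fst.prodMk
          ((hasFDerivAt_snd.pow 3).neg.sub (hasFDerivAt_fst.mul hasFDerivAt_snd))
      rw [h.fderiv]
      ext
      · simp
      · simp
        ring
    refine exists_openPartialHomeomorph hC.contDiffAt fun v w hvw ↦ ?_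
    rw [hder, hder, Prod.mk.injEq] at hvw
    obtain ⟨h1, h2⟩ := hvw
    rw [h1, sub_left_inj] at h2
    exact Prod.ext h1 (mul_left_cancel₀ hd h2)
  refine isProperMap_cubicOfRoot.isClosedMap.isCoveringMapOn_of_isLocalHomeomorphOn
    (fun c hc ↦ ?_) hloc
  refine (isProperMap_cubicOfRoot.isCompact_preimage isCompact_singleton).finite
    (.of_openPartialHomeomorph _ subset_rfl fun e he ↦ ?_)
  obtain ⟨φ, h1, h2⟩ := hloc e (by rwa [Set.mem_preimage, show cubicOfRoot e = c from he])
  exact ⟨φ, h1, h2.symm⟩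

lemma isSimplyConnected_upperHalfPlaneSet : IsSimplyConnected upperHalfPlaneSet :=
  have := (convex_halfSpace_im_gt 0).contractibleSpace
    ⟨Complex.I, show 0 < Complex.I.im from one_pos.trans_eq Complex.I_im.symm⟩
  SimplyConnectedSpace.ofContractible _

/-- The upper half plane is simply connected, so one root of the cubic can be followed
continuously; the other two come from a square root of the discriminant of the quotient. -/
theorem exists_isRootTriple : ∃ N : Fin 3 → ℂ → ℂ, IsRootTriple N := by
  have hcP : ContinuousOn depressedP upperHalfPlaneSet := fun τ hτ ↦
    (((hasDerivAt_deriv_γ hτ).continuousAt.const_mul _).sub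
      (((hasDerivAt_γ hτ).continuousAt.pow 2).const_mul _)).continuousWithinAt
  have hcQ : ContinuousOn depressedQ upperHalfPlaneSet := fun τ hτ ↦
    (((((hasDerivAt_γ hτ).continuousAt.pow 3).sub
      (((hasDerivAt_γ hτ).continuousAt.const_mul 3).mul (hasDerivAt_deriv_γ hτ).continuousAt)).add
      (hasDerivAt_deriv_deriv_γ hτ).continuousAt).const_mul _).continuousWithinAt
  let f : C(ℍ, ℂ × ℂ) := ⟨fun τ ↦ (depressedP τ, depressedQ τ),
    (hcP.comp_continuous continuous_coe fun τ ↦ τ.im_pos).prodMk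
      (hcQ.comp_continuous continuous_coe fun τ ↦ τ.im_pos)⟩
  -- Over `i`, any root will do as starting point.
  obtain ⟨x₀, hx₀⟩ : ∃ x : ℂ, x ^ 3 + depressedP UpperHalfPlane.I * x +
      depressedQ UpperHalfPlane.I = 0 := by
    have hdeg : (Polynomial.X ^ 3 + Polynomial.C (depressedP UpperHalfPlane.I) * Polynomial.X +
        Polynomial.C (depressedQ UpperHalfPlane.I)).degree ≠ 0 := by
      rw [show (_ : Polynomial ℂ).degree = 3 by compute_degree!]
      decide
    obtain ⟨x, hx⟩ := IsAlgClosed.exists_root _ hdeg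
    exact ⟨x, by simpa using hx⟩
  obtain ⟨G, ⟨-, hG⟩, -⟩ := isCoveringMapOn_cubicOfRoot.existsUnique_continuousMap_lifts f
    (a₀ := UpperHalfPlane.I) (e₀ := (depressedP UpperHalfPlane.I, x₀))
    (Prod.ext rfl (by simp only [cubicOfRoot]; exact (by linear_combination -hx₀)))
    fun τ ↦ depressed_discr_ne_zero τ.im_pos
  set y : ℂ → ℂ := fun τ ↦ (G (ofComplex τ)).2 with hy
  have hroot : ∀ τ ∈ upperHalfPlaneSet, y τ ^ 3 + depressedP τ * y τ + depressedQ τ = 0 := by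
    intro τ hτ
    have h := congrFun hG (ofComplex τ)
    have h1 : (G (ofComplex τ)).1 = depressedP τ := by
      simpa [f, cubicOfRoot, ofComplex_apply_of_im_pos hτ] using! congrArg Prod.fst h
    have h2 : -(G (ofComplex τ)).2 ^ 3 - (G (ofComplex τ)).1 * (G (ofComplex τ)).2 =
        depressedQ τ := by
      simpa [f, cubicOfRoot, ofComplex_apply_of_im_pos hτ] using! congrArg Prod.snd h
    rw [h1] at h2
    simp only [hy]
    linear_combination -h2
  have hyc : ContinuousOn y upperHalfPlaneSet := by
    have : ContinuousOn ofComplex upperHalfPlaneSet :=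
      ofComplex.continuousOn.mono fun τ hτ ↦ by
        simp only [ofComplex, OpenPartialHomeomorph.symm_source,
          Topology.IsOpenEmbedding.toOpenPartialHomeomorph_target]
        exact ⟨⟨τ, hτ⟩, rfl⟩
    exact (continuous_snd.comp G.continuous).comp_continuousOn this
  -- `-3y² - 4p` is the discriminant of the quotient `x² + y x + (y² + p)` by `x - y`; where it
  -- vanishes, the cubic has a multiple root.
  obtain ⟨r, hrc, hr⟩ := Complex.exists_continuousOn_pow_eq isSimplyConnected_upperHalfPlaneSet
    isOpen_upperHalfPlaneSet
    (g := fun τ ↦ -3 * y τ ^ 2 - 4 * depressedP τ)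
    (((hyc.pow 2).const_mul _).sub (hcP.const_mul _)) (n := 2) (by
      rintro ⟨τ, hτ, h0⟩
      refine depressed_discr_ne_zero hτ ?_
      have h1 := hroot τ hτ
      have hP : depressedP τ = -(3 / 4) * y τ ^ 2 := by linear_combination -h0 / 4
      have hQ : depressedQ τ = -(1 / 4) * y τ ^ 3 := by
        rw [hP] at h1
        linear_combination h1
      rw [hP, hQ]
      ring) two_ne_zero
  have hcγ : ContinuousOn γ upperHalfPlaneSet := fun τ hτ ↦
    (hasDerivAt_γ hτ).continuousAt.continuousWithinAt
  refine ⟨![fun τ ↦ y τ - γ τ / 2, fun τ ↦ (-y τ + r τ) / 2 - γ τ / 2,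
    fun τ ↦ (-y τ - r τ) / 2 - γ τ / 2], ?_, ?_⟩
  · intro i
    fin_cases i
    · exact hyc.sub (hcγ.div_const 2)
    · exact ((hyc.neg.add hrc).div_const 2).sub (hcγ.div_const 2)
    · exact ((hyc.neg.sub hrc).div_const 2).sub (hcγ.div_const 2)
  · intro τ hτ x
    have h1 := hroot τ hτ
    have h2 := hr τ
    simp only [Matrix.cons_val_zero, Matrix.cons_val_one, Matrix.cons_val]
    rw [depressedP, depressedQ] at h1
    simp only [depressedP] at h2
    linear_combination h1 + (x - y τ + γ τ / 2) / 4 * h2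

/-! ### The roots solve the Halphen system -/

/-- A continuous solution `f` of an equation whose difference quotient factors through a
nonvanishing continuous `A` is differentiable. -/
lemma hasDerivAt_of_sub_mul_eq {f A B : ℂ → ℂ} {b τ : ℂ}
    (h : ∀ᶠ z in 𝓝 τ, (f z - f τ) * A z = B z) (hA : ContinuousAt A τ) (hA0 : A τ ≠ 0)
    (hB : HasDerivAt B b τ) : HasDerivAt f (b / A τ) τ := by
  rw [hasDerivAt_iff_tendsto_slope] at hB ⊢
  have hBτ : B τ = 0 := by simpa using h.self_of_nhds.symm
  refine (hB.div (hA.tendsto.mono_left nhdsWithin_le_nhds) hA0).congr' ?_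
  filter_upwards [nhdsWithin_le_nhds h, nhdsWithin_le_nhds (hA.eventually_ne hA0)] with z hz hz0
  rw [Pi.div_apply, slope_def_field, slope_def_field, hBτ, ← hz, sub_zero]
  field_simp

namespace IsRootTriple

variable {N : Fin 3 → ℂ → ℂ} (hN : IsRootTriple N) {τ : ℂ} (hτ : τ ∈ upperHalfPlaneSet)

include hN hτ

lemma γ_eq : γ τ = -(2 / 3) * (N 0 τ + N 1 τ + N 2 τ) := by
  have h0 := hN.factor τ hτ 0
  have h1 := hN.factor τ hτ 1
  have h2 := hN.factor τ hτ (-1)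
  linear_combination (h1 + h2 - 2 * h0) / 3

lemma deriv_γ_eq : deriv γ τ = 2 / 3 * (N 0 τ * N 1 τ + N 0 τ * N 2 τ + N 1 τ * N 2 τ) := by
  have h1 := hN.factor τ hτ 1
  have h2 := hN.factor τ hτ (-1)
  linear_combination (h1 - h2) / 3

lemma deriv_deriv_γ_eq : deriv (deriv γ) τ = -4 * (N 0 τ * N 1 τ * N 2 τ) := by
  linear_combination 4 * hN.factor τ hτ 0

lemma isRoot (i : Fin 3) : N i τ ^ 3 + 3 / 2 * γ τ * N i τ ^ 2 + 3 / 2 * deriv γ τ * N i τ +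
    1 / 4 * deriv (deriv γ) τ = 0 := by
  rw [hN.factor τ hτ (N i τ)]
  fin_cases i <;> simp

/-- The square of the product of differences is minus `4p³ + 27q²` for the depressed cubic. -/
lemma vandermonde_ne_zero :
    (N 0 τ - N 1 τ) * (N 0 τ - N 2 τ) * (N 1 τ - N 2 τ) ≠ 0 := by
  intro h
  refine depressed_discr_ne_zero hτ ?_
  rw [depressedP, depressedQ, hN.γ_eq hτ, hN.deriv_γ_eq hτ, hN.deriv_deriv_γ_eq hτ]
  linear_combination -((N 0 τ - N 1 τ) * (N 0 τ - N 2 τ) * (N 1 τ - N 2 τ)) * h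

lemma sub_ne_zero_01 : N 0 τ - N 1 τ ≠ 0 :=
  left_ne_zero_of_mul (left_ne_zero_of_mul (hN.vandermonde_ne_zero hτ))

lemma sub_ne_zero_02 : N 0 τ - N 2 τ ≠ 0 :=
  right_ne_zero_of_mul (left_ne_zero_of_mul (hN.vandermonde_ne_zero hτ))

lemma sub_ne_zero_12 : N 1 τ - N 2 τ ≠ 0 :=
  right_ne_zero_of_mul (hN.vandermonde_ne_zero hτ)

theorem injective : Function.Injective fun i ↦ N i τ := by
  have h01 := sub_ne_zero.mp (hN.sub_ne_zero_01 hτ)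
  have h02 := sub_ne_zero.mp (hN.sub_ne_zero_02 hτ)
  have h12 := sub_ne_zero.mp (hN.sub_ne_zero_12 hτ)
  intro i j hij
  fin_cases i <;> fin_cases j <;> simp_all

lemma continuousAt (i : Fin 3) : ContinuousAt (N i) τ :=
  (hN.continuousOn i).continuousAt (isOpen_upperHalfPlaneSet.mem_nhds hτ)

/-- Differentiating the cubic along a root and eliminating `γ'''` by Chazy's equation gives a
Riccati equation for the root. -/
theorem hasDerivAt (i : Fin 3) :
    HasDerivAt (N i) (2 * N i τ ^ 2 + 3 * γ τ * N i τ + 3 / 2 * deriv γ τ) τ := by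
  set x := N i τ with hx
  have hA0 : 3 * x ^ 2 + 3 * γ τ * x + 3 / 2 * deriv γ τ ≠ 0 := by
    have h01 := hN.sub_ne_zero_01 hτ
    have h02 := hN.sub_ne_zero_02 hτ
    have h12 := hN.sub_ne_zero_12 hτ
    rw [hN.γ_eq hτ, hN.deriv_γ_eq hτ]
    fin_cases i
    · convert mul_ne_zero h01 h02 using 1
      simp only [hx, Fin.zero_eta]
      ring
    · convert mul_ne_zero (neg_ne_zero.mpr h01) h12 using 1
      simp only [hx, Fin.mk_one]
      ring
    · convert mul_ne_zero h02 h12 using 1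
      simp only [hx, Fin.reduceFinMk]
      ring
  have hc := hN.continuousAt hτ i
  -- Subtracting from the cubic at `z` the same expression with the root frozen at `x` leaves
  -- `N i z - x` times the divided difference `A`, whose value at `τ` is the derivative of the
  -- cubic.
  have hA : ContinuousAt (fun z ↦ N i z ^ 2 + N i z * x + x ^ 2 +
      3 / 2 * γ z * (N i z + x) + 3 / 2 * deriv γ z) τ :=
    ((((hc.pow 2).add (hc.mul_const x)).add_const _).add
      (((hasDerivAt_γ hτ).continuousAt.const_mul _).mul (hc.add_const x))).add
      ((hasDerivAt_deriv_γ hτ).continuousAt.const_mul _)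
  have hB := (((((hasDerivAt_γ hτ).const_mul (3 / 2)).mul_const (x ^ 2)).const_add (x ^ 3)).add
    (((hasDerivAt_deriv_γ hτ).const_mul (3 / 2)).mul_const x)).add
    ((hasDerivAt_deriv_deriv_γ hτ).const_mul (1 / 4)) |>.neg
  have h := hasDerivAt_of_sub_mul_eq (f := N i) ?_ hA (by
    rw [← hx]
    convert hA0 using 1
    ring) hB
  · refine h.congr_deriv ?_
    rw [← hx, div_eq_iff (by convert hA0 using 1; ring)]
    have hr := hN.isRoot hτ i
    rw [← hx] at hr
    linear_combination -(6 * x + 6 * γ τ) * hr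
  · filter_upwards [eventually_mem_upperHalfPlaneSet hτ] with z hz
    have hr := hN.isRoot hz i
    simp only [Pi.neg_apply, Pi.add_apply]
    linear_combination hr

/-- The Riccati equation with `γ`, `γ'` expressed in the roots is the first equation of the Halphen
system. -/
lemma hasDerivAt_zero : HasDerivAt (N 0) (N 1 τ * N 2 τ - N 0 τ * (N 1 τ + N 2 τ)) τ :=
  (hN.hasDerivAt hτ 0).congr_deriv (by rw [hN.γ_eq hτ, hN.deriv_γ_eq hτ]; ring)

lemma hasDerivAt_one : HasDerivAt (N 1) (N 0 τ * N 2 τ - N 1 τ * (N 0 τ + N 2 τ)) τ :=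
  (hN.hasDerivAt hτ 1).congr_deriv (by rw [hN.γ_eq hτ, hN.deriv_γ_eq hτ]; ring)

lemma hasDerivAt_two : HasDerivAt (N 2) (N 0 τ * N 1 τ - N 2 τ * (N 0 τ + N 1 τ)) τ :=
  (hN.hasDerivAt hτ 2).congr_deriv (by rw [hN.γ_eq hτ, hN.deriv_γ_eq hτ]; ring)

end IsRootTriple

/-! ### The Frobenius manifold -/

lemma isOpen_domain : IsOpen domain :=
  isOpen_lt continuous_const (Complex.continuous_im.comp (continuous_apply 2))

lemma pderiv_congr {f g : (Fin 3 → ℂ) → ℂ} (h : ∀ t ∈ domain, f t = g t) (i : Fin 3)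
    {t : Fin 3 → ℂ} (ht : t ∈ domain) : pderiv i f t = pderiv i g t := by
  have : f =ᶠ[𝓝 t] g := by filter_upwards [isOpen_domain.mem_nhds ht] with z hz using h z hz
  rw [pderiv, pderiv, this.fderiv_eq]

lemma hasFDerivAt_coord (i : Fin 3) (t : Fin 3 → ℂ) :
    HasFDerivAt (fun s : Fin 3 → ℂ ↦ s i) (ContinuousLinearMap.proj (R := ℂ) i) t :=
  hasFDerivAt_apply i t

lemma hasFDerivAt_comp_coord_two {g : ℂ → ℂ} {g' : ℂ} {t : Fin 3 → ℂ}
    (hg : HasDerivAt g g' (t 2)) :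
    HasFDerivAt (fun s : Fin 3 → ℂ ↦ g (s 2)) (g' • ContinuousLinearMap.proj (R := ℂ) 2) t :=
  hg.comp_hasFDerivAt t (hasFDerivAt_coord 2 t)

/-- The gradient of the potential. -/
def potentialGrad (k : Fin 3) (t : Fin 3 → ℂ) : ℂ :=
  ![t 0 * t 2 + 1 / 2 * t 1 ^ 2, t 0 * t 1 - 1 / 4 * t 1 ^ 3 * γ (t 2),
    1 / 2 * t 0 ^ 2 - 1 / 16 * t 1 ^ 4 * deriv γ (t 2)] k

/-- The Hessian of the potential. -/
def potentialHess (j k : Fin 3) (t : Fin 3 → ℂ) : ℂ :=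
  ![![t 2, t 1, t 0],
    ![t 1, t 0 - 3 / 4 * t 1 ^ 2 * γ (t 2), -(1 / 4 * t 1 ^ 3 * deriv γ (t 2))],
    ![t 0, -(1 / 4 * t 1 ^ 3 * deriv γ (t 2)), -(1 / 16 * t 1 ^ 4 * deriv (deriv γ) (t 2))]] j k

/-- The third derivatives of the potential, with `γ'''` eliminated by Chazy's equation. -/
def potentialThird (t : Fin 3 → ℂ) (i j k : Fin 3) : ℂ :=
  ![![![0, 0, 1], ![0, 1, 0], ![1, 0, 0]],
    ![![0, 1, 0],
      ![1, -(3 / 2 * t 1 * γ (t 2)), -(3 / 4 * t 1 ^ 2 * deriv γ (t 2))],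
      ![0, -(3 / 4 * t 1 ^ 2 * deriv γ (t 2)), -(1 / 4 * t 1 ^ 3 * deriv (deriv γ) (t 2))]],
    ![![1, 0, 0],
      ![0, -(3 / 4 * t 1 ^ 2 * deriv γ (t 2)), -(1 / 4 * t 1 ^ 3 * deriv (deriv γ) (t 2))],
      ![0, -(1 / 4 * t 1 ^ 3 * deriv (deriv γ) (t 2)),
        -(1 / 16 * t 1 ^ 4 *
          (6 * γ (t 2) * deriv (deriv γ) (t 2) - 9 * deriv γ (t 2) ^ 2))]]] i j k

section Derivatives

variable {t : Fin 3 → ℂ} (ht : t ∈ domain)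

include ht

lemma hasFDerivAt_potential : ∃ T : (Fin 3 → ℂ) →L[ℂ] ℂ, HasFDerivAt potential T t ∧
    ∀ k, T (Pi.single k 1) = potentialGrad k t := by
  have h0 := hasFDerivAt_coord 0 t
  have h1 := hasFDerivAt_coord 1 t
  have h2 := hasFDerivAt_coord 2 t
  have hγ := hasFDerivAt_comp_coord_two (hasDerivAt_γ (τ := t 2) ht)
  have h := ((((h0.pow 2).const_mul (1 / 2)).mul h2).add
    ((h0.const_mul (1 / 2)).mul (h1.pow 2))).sub (((h1.pow 4).const_mul (1 / 16)).mul hγ)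
  refine ⟨_, h.congr_of_eventuallyEq (Eventually.of_forall fun s ↦ ?_), fun k ↦ ?_⟩
  · simp only [potential, Pi.sub_apply, Pi.add_apply, Pi.mul_apply]
    ring
  · fin_cases k <;> simp [potentialGrad] <;> ring

lemma pderiv_potential (k : Fin 3) : pderiv k potential t = potentialGrad k t := by
  obtain ⟨T, hT, hval⟩ := hasFDerivAt_potential ht
  rw [pderiv, hT.fderiv, hval]

lemma pderiv_potentialGrad (j k : Fin 3) : pderiv j (potentialGrad k) t = potentialHess j k t := by
  have h0 := hasFDerivAt_coord 0 t
  have h1 := hasFDerivAt_coord 1 t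
  have h2 := hasFDerivAt_coord 2 t
  have hγ := hasFDerivAt_comp_coord_two (hasDerivAt_γ (τ := t 2) ht)
  have hγ' := hasFDerivAt_comp_coord_two (hasDerivAt_deriv_γ (τ := t 2) ht)
  fin_cases k
  · have h : HasFDerivAt (potentialGrad 0) _ t := (h0.mul h2).add ((h1.pow 2).const_mul (1 / 2))
    simp only [Fin.zero_eta, pderiv, h.fderiv]
    fin_cases j <;> simp [potentialHess]
  · have h : HasFDerivAt (potentialGrad 1) _ t :=
      (h0.mul h1).sub (((h1.pow 3).const_mul (1 / 4)).mul hγ)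
    simp only [Fin.mk_one, pderiv, h.fderiv]
    fin_cases j <;> simp [potentialHess]
    ring
  · have h : HasFDerivAt (potentialGrad 2) _ t :=
      ((h0.pow 2).const_mul (1 / 2)).sub (((h1.pow 4).const_mul (1 / 16)).mul hγ')
    simp only [Fin.reduceFinMk, pderiv, h.fderiv]
    fin_cases j <;> simp [potentialHess]
    ring

lemma pderiv_potentialHess (i j k : Fin 3) :
    pderiv i (potentialHess j k) t = potentialThird t i j k := by
  have h0 := hasFDerivAt_coord 0 t
  have h1 := hasFDerivAt_coord 1 t
  have h2 := hasFDerivAt_coord 2 t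
  have hγ := hasFDerivAt_comp_coord_two (hasDerivAt_γ (τ := t 2) ht)
  have hγ' := hasFDerivAt_comp_coord_two (hasDerivAt_deriv_γ (τ := t 2) ht)
  have hγ'' := hasFDerivAt_comp_coord_two (hasDerivAt_deriv_deriv_γ (τ := t 2) ht)
  have h11 := h0.sub (((h1.pow 2).const_mul (3 / 4)).mul hγ)
  have h12 := (((h1.pow 3).const_mul (1 / 4)).mul hγ').neg
  have h22 := (((h1.pow 4).const_mul (1 / 16)).mul hγ'').neg
  obtain ⟨T, hT, hval⟩ : ∃ T : (Fin 3 → ℂ) →L[ℂ] ℂ, HasFDerivAt (potentialHess j k) T t ∧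
      ∀ i, T (Pi.single i 1) = potentialThird t i j k := by
    fin_cases j <;> fin_cases k
    · exact ⟨_, h2, fun i ↦ by fin_cases i <;> simp [potentialThird]⟩
    · exact ⟨_, h1, fun i ↦ by fin_cases i <;> simp [potentialThird]⟩
    · exact ⟨_, h0, fun i ↦ by fin_cases i <;> simp [potentialThird]⟩
    · exact ⟨_, h1, fun i ↦ by fin_cases i <;> simp [potentialThird]⟩
    · exact ⟨_, h11, fun i ↦ by fin_cases i <;> simp [potentialThird]; ring⟩
    · exact ⟨_, h12, fun i ↦ by fin_cases i <;> simp [potentialThird]; ring⟩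
    · exact ⟨_, h0, fun i ↦ by fin_cases i <;> simp [potentialThird]⟩
    · exact ⟨_, h12, fun i ↦ by fin_cases i <;> simp [potentialThird]; ring⟩
    · exact ⟨_, h22, fun i ↦ by fin_cases i <;> simp [potentialThird]; ring⟩
  rw [pderiv, hT.fderiv, hval]

lemma C₃_potential (i j k : Fin 3) : C₃ potential t i j k = potentialThird t i j k := by
  have h1 : ∀ s ∈ domain, pderiv j (pderiv k potential) s = potentialHess j k s := fun s hs ↦ by
    rw [pderiv_congr (fun r hr ↦ pderiv_potential hr k) j hs, pderiv_potentialGrad hs]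
  rw [C₃, pderiv_congr h1 i ht, pderiv_potentialHess ht]

lemma eta_potential : eta potential t = !![0, 0, 1; 0, 1, 0; 1, 0, 0] := by
  ext i j
  rw [eta, Matrix.of_apply, C₃_potential ht]
  fin_cases i <;> fin_cases j <;> rfl

lemma metric_potential (v w : Fin 3 → ℂ) :
    metric potential t v w = v 1 * w 1 + (v 0 * w 2 + v 2 * w 0) := by
  simp [metric, eta_potential ht, Fin.sum_univ_three]
  ring

lemma structConst_potential (i j k : Fin 3) :
    structConst potential t i j k = potentialThird t k.rev i j := by
  have hinv : (!![0, 0, 1; 0, 1, 0; 1, 0, 0] : Matrix (Fin 3) (Fin 3) ℂ)⁻¹ =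
      !![0, 0, 1; 0, 1, 0; 1, 0, 0] := by
    refine Matrix.inv_eq_right_inv ?_
    ext i j
    fin_cases i <;> fin_cases j <;> simp [Matrix.mul_apply, Fin.sum_univ_three]
  simp only [structConst, eta_potential ht, hinv, C₃_potential ht, Fin.sum_univ_three]
  fin_cases k <;> simp [Fin.rev]

/-- The multiplication in coordinates, with `γ'''` eliminated by Chazy's equation. -/
lemma mul_potential (v w : Fin 3 → ℂ) (k : Fin 3) : mul potential t v w k =
    ![v 0 * w 0 - 3 / 4 * t 1 ^ 2 * deriv γ (t 2) * (v 1 * w 1) -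
        1 / 4 * t 1 ^ 3 * deriv (deriv γ) (t 2) * (v 1 * w 2 + v 2 * w 1) -
        1 / 16 * t 1 ^ 4 * (6 * γ (t 2) * deriv (deriv γ) (t 2) - 9 * deriv γ (t 2) ^ 2) *
          (v 2 * w 2),
      v 0 * w 1 + v 1 * w 0 - 3 / 2 * t 1 * γ (t 2) * (v 1 * w 1) -
        3 / 4 * t 1 ^ 2 * deriv γ (t 2) * (v 1 * w 2 + v 2 * w 1) -
        1 / 4 * t 1 ^ 3 * deriv (deriv γ) (t 2) * (v 2 * w 2),
      v 0 * w 2 + v 1 * w 1 + v 2 * w 0] k := by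
  simp only [mul, structConst_potential ht, Fin.sum_univ_three]
  fin_cases k <;> simp [potentialThird, Fin.rev] <;> ring

end Derivatives

theorem isFrobeniusManifold_potential : IsFrobeniusManifold domain potential euler 1 where
  isOpen := isOpen_domain
  holomorphic := fun t ht ↦ by
    obtain ⟨T, hT, -⟩ := hasFDerivAt_potential ht
    exact hT.differentiableAt.differentiableWithinAt
  eta_const := ⟨!![0, 0, 1; 0, 1, 0; 1, 0, 0], by simp [Matrix.det_fin_three],
    fun t ht ↦ eta_potential ht⟩
  mul_comm := fun t ht v w ↦ by
    ext k
    rw [mul_potential ht, mul_potential ht]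
    fin_cases k <;> simp <;> ring
  mul_assoc := fun t ht v w x ↦ by
    ext k
    rw [mul_potential ht, mul_potential ht]
    simp only [mul_potential ht]
    fin_cases k <;> simp <;> ring
  one_mul := fun t ht v ↦ by
    ext k
    rw [mul_potential ht]
    fin_cases k <;> simp
  euler_affine := ⟨!![1, 0, 0; 0, 1 / 2, 0; 0, 0, 0], 0, by
      ext i
      fin_cases i <;> simp [Matrix.mulVec, dotProduct, Fin.sum_univ_three],
    fun t _ ↦ by
      ext i
      fin_cases i <;> simp [euler, dotProduct, Fin.sum_univ_three]⟩
  quasihomogeneous := ⟨0, by simp, fun t ht ↦ by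
    simp only [Fin.sum_univ_three, pderiv_potential ht, euler, potentialGrad, potential, map_zero]
    simp
    ring⟩

/-! ### Canonical coordinates -/

/-- The derivative `dN/dτ = 2N² + 3γN + (3/2)γ'` of a root, as an expression in the root. -/
def rootSlope (N : Fin 3 → ℂ → ℂ) (i : Fin 3) (τ : ℂ) : ℂ :=
  2 * N i τ ^ 2 + 3 * γ τ * N i τ + 3 / 2 * deriv γ τ

/-- The value `duᵢ(v)` of the differential of the `i`-th canonical coordinate at `t`. -/
def canonicalDiff (N : Fin 3 → ℂ → ℂ) (t v : Fin 3 → ℂ) (i : Fin 3) : ℂ :=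
  v 0 + t 1 * N i (t 2) * v 1 + 1 / 2 * t 1 ^ 2 * rootSlope N i (t 2) * v 2

lemma canonicalDiff_euler (N : Fin 3 → ℂ → ℂ) (t : Fin 3 → ℂ) :
    canonicalDiff N t (euler t) = canonicalCoord N t := by
  ext i
  simp [canonicalDiff, euler, canonicalCoord]
  ring

namespace IsRootTriple

variable {N : Fin 3 → ℂ → ℂ} (hN : IsRootTriple N) {t : Fin 3 → ℂ} (ht : t ∈ domain)

include hN ht

lemma hasFDerivAt_canonicalCoord_apply (i : Fin 3) :
    ∃ T : (Fin 3 → ℂ) →L[ℂ] ℂ, HasFDerivAt (fun s ↦ canonicalCoord N s i) T t ∧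
      ∀ v, T v = canonicalDiff N t v i := by
  have h0 := hasFDerivAt_coord 0 t
  have h1 := hasFDerivAt_coord 1 t
  have hn := hasFDerivAt_comp_coord_two (hN.hasDerivAt (τ := t 2) ht i)
  refine ⟨_, h0.add (((h1.pow 2).const_mul (1 / 2)).mul hn), fun v ↦ ?_⟩
  simp [canonicalDiff, rootSlope]
  ring

lemma differentiableAt_canonicalCoord : DifferentiableAt ℂ (canonicalCoord N) t :=
  differentiableAt_pi.mpr fun i ↦ by
    obtain ⟨T, hT, -⟩ := hN.hasFDerivAt_canonicalCoord_apply ht i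
    exact hT.differentiableAt

lemma fderiv_canonicalCoord (v : Fin 3 → ℂ) :
    fderiv ℂ (canonicalCoord N) t v = canonicalDiff N t v := by
  ext i
  obtain ⟨T, hT, hval⟩ := hN.hasFDerivAt_canonicalCoord_apply ht i
  have h := (hasFDerivAt_pi'.mp (hN.differentiableAt_canonicalCoord ht).hasFDerivAt i).unique hT
  rw [← hval, ← h]
  rfl

/-- The differentials `duᵢ` are characters of the algebra on the tangent space. -/
lemma canonicalDiff_mul (v w : Fin 3 → ℂ) :
    canonicalDiff N t (mul potential t v w) = canonicalDiff N t v * canonicalDiff N t w := by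
  ext i
  have hr := hN.isRoot (τ := t 2) ht i
  simp only [Pi.mul_apply, canonicalDiff, rootSlope, mul_potential ht, Matrix.cons_val_zero,
    Matrix.cons_val_one, Matrix.cons_val]
  set n := N i (t 2)
  set g := γ (t 2)
  set g₁ := deriv γ (t 2)
  set g₂ := deriv (deriv γ) (t 2)
  linear_combination (-(t 1 ^ 3) * (v 1 * w 2 + v 2 * w 1) -
    t 1 ^ 4 * (n + 3 / 2 * g) * (v 2 * w 2)) * hr

/-- Off `t₂ = 0` the three differentials `duᵢ` are independent. -/
lemma injective_fderiv_canonicalCoord (ht1 : t 1 ≠ 0) :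
    Function.Injective (fderiv ℂ (canonicalCoord N) t) := by
  rw [injective_iff_map_eq_zero]
  intro v hv
  rw [hN.fderiv_canonicalCoord ht] at hv
  have hγ := hN.γ_eq (τ := t 2) ht
  have hγ' := hN.deriv_γ_eq (τ := t 2) ht
  have e0 := congrFun hv 0
  have e1 := congrFun hv 1
  have e2 := congrFun hv 2
  simp only [canonicalDiff, rootSlope, Pi.zero_apply, hγ, hγ'] at e0 e1 e2
  have h01 := hN.sub_ne_zero_01 (τ := t 2) ht
  have h02 := hN.sub_ne_zero_02 (τ := t 2) ht
  have h12 := hN.sub_ne_zero_12 (τ := t 2) ht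
  set a := N 0 (t 2)
  set b := N 1 (t 2)
  set c := N 2 (t 2)
  -- Successive divided differences eliminate `v 0`, then `v 1`.
  have d01 : t 1 * v 1 - t 1 ^ 2 * c * v 2 = 0 :=
    mul_left_cancel₀ h01 (by linear_combination e0 - e1)
  have d02 : t 1 * v 1 - t 1 ^ 2 * b * v 2 = 0 :=
    mul_left_cancel₀ h02 (by linear_combination e0 - e2)
  have hv2 : v 2 = 0 := by
    have : (b - c) * (t 1 ^ 2 * v 2) = 0 := by linear_combination d01 - d02
    simpa [h12, ht1] using this
  have hv1 : v 1 = 0 := by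
    rw [hv2] at d01
    simpa [ht1] using d01
  have hv0 : v 0 = 0 := by
    rw [hv1, hv2] at e0
    simpa using e0
  ext i
  fin_cases i <;> assumption

lemma canonicalCoord_ne (ht1 : t 1 ≠ 0) {i j : Fin 3} (hij : i ≠ j) :
    canonicalCoord N t i ≠ canonicalCoord N t j := by
  intro h
  refine hij (hN.injective (τ := t 2) ht ?_)
  simpa [canonicalCoord, ht1] using h

theorem isCanonicalCoordinatesAt (ht1 : t 1 ≠ 0) :
    IsCanonicalCoordinatesAt domain potential euler (canonicalCoord N) t := by
  set S : Set (Fin 3 → ℂ) := domain ∩ {s | s 1 ≠ 0}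
  have hS : IsOpen S := isOpen_domain.inter (isOpen_ne_fun (continuous_apply 1) continuous_const)
  have hC : ContDiffOn ℂ 1 (canonicalCoord N) S := by
    have hNi : ∀ i, ContDiffOn ℂ 1 (fun s : Fin 3 → ℂ ↦ N i (s 2)) S := fun i ↦ by
      have : ContDiffOn ℂ 1 (N i) upperHalfPlaneSet := DifferentiableOn.contDiffOn
        (fun τ hτ ↦ (hN.hasDerivAt hτ i).differentiableAt.differentiableWithinAt)
        isOpen_upperHalfPlaneSet
      exact this.comp (contDiff_apply ℂ ℂ 2).contDiffOn fun s hs ↦ hs.1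
    exact contDiffOn_pi.mpr fun i ↦ (contDiff_apply ℂ ℂ 0).contDiffOn.add
      ((contDiff_const.mul ((contDiff_apply ℂ ℂ 1).pow 2)).contDiffOn.mul (hNi i))
  obtain ⟨φ, htφ, hφS, hφ, hd, hds⟩ := exists_holomorphic_chart hS hC
    (fun s hs ↦ hN.injective_fderiv_canonicalCoord hs.1 hs.2) ⟨ht, ht1⟩
  refine ⟨φ, htφ, fun s hs ↦ (hφS hs).1, fun s _ ↦ (congrFun hφ s).symm, hd, hds, fun s hs ↦ ?_⟩
  have hsd : s ∈ domain := (hφS hs).1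
  have hinj := hN.injective_fderiv_canonicalCoord hsd (hφS hs).2
  have hcomp : ∀ v, canonicalDiff N s (fderiv ℂ φ.symm (φ s) v) = v := fun v ↦ by
    rw [← hN.fderiv_canonicalCoord hsd, hφ]
    exact fderiv_fderiv_symm_apply hs (hd.differentiableAt (φ.open_source.mem_nhds hs))
      (hds.differentiableAt (φ.open_target.mem_nhds (φ.map_source hs))) v
  refine ⟨fun i j ↦ hinj ?_, hinj ?_⟩
  · rw [hN.fderiv_canonicalCoord hsd, hN.canonicalDiff_mul hsd, hcomp, hcomp]
    split_ifs with hij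
    · rw [hN.fderiv_canonicalCoord hsd, hcomp, hij]
      ext k
      by_cases hk : k = j <;> simp [hk]
    · rw [map_zero]
      ext k
      by_cases hk : k = j
      · have : k ≠ i := fun h ↦ hij (h.symm.trans hk)
        simp [this]
      · simp [hk]
  · have hterm : ∀ c, fderiv ℂ (canonicalCoord N) s
        (canonicalCoord N s c • fderiv ℂ φ.symm (φ s) (Pi.single c 1)) =
          canonicalCoord N s c • Pi.single c 1 := fun c ↦ by
      rw [map_smul, hN.fderiv_canonicalCoord hsd, hcomp]
    rw [map_sum, Finset.sum_congr rfl fun c _ ↦ hterm c, hN.fderiv_canonicalCoord hsd,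
      canonicalDiff_euler]
    ext k
    simp [Finset.sum_apply, Pi.single_apply]

/-- Each idempotent coordinate field `∂/∂vᵢ` is sent to `1` by some `duⱼ`, and then `vᵢ = uⱼ`. -/
lemma exists_canonicalDiff_eq_one {v : (Fin 3 → ℂ) → (Fin 3 → ℂ)} (ht1 : t 1 ≠ 0)
    {del : Fin 3 → Fin 3 → ℂ} (hdel0 : ∀ i, del i ≠ 0)
    (hmul : ∀ i j, mul potential t (del i) (del j) = if i = j then del i else 0)
    (hE : euler t = ∑ i, v t i • del i) (i : Fin 3) :
    ∃ j, canonicalDiff N t (del i) j = 1 ∧ v t i = canonicalCoord N t j := by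
  have hlin : ∀ w, canonicalDiff N t w = fderiv ℂ (canonicalCoord N) t w :=
    fun w ↦ (hN.fderiv_canonicalCoord ht w).symm
  obtain ⟨j, hj⟩ : ∃ j, canonicalDiff N t (del i) j ≠ 0 := by
    by_contra! h
    refine hdel0 i (hN.injective_fderiv_canonicalCoord ht ht1 ?_)
    rw [← hlin, map_zero]
    exact funext h
  have hjj : canonicalDiff N t (del i) j = 1 := by
    have h := congrFun (hN.canonicalDiff_mul ht (del i) (del i)) j
    rw [hmul, if_pos rfl, Pi.mul_apply] at h
    exact mul_left_cancel₀ hj (by rw [← h, mul_one])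
  have hkj : ∀ k, k ≠ i → canonicalDiff N t (del k) j = 0 := fun k hk ↦ by
    have h := congrFun (hN.canonicalDiff_mul ht (del k) (del i)) j
    rw [hmul, if_neg hk, Pi.mul_apply, hjj, mul_one, hlin, map_zero] at h
    exact h.symm
  refine ⟨j, hjj, ?_⟩
  have h := congrFun (canonicalDiff_euler N t) j
  rw [hE, hlin, map_sum, Finset.sum_apply, Finset.sum_eq_single i] at h
  · rw [map_smul, ← hlin, Pi.smul_apply, hjj, smul_eq_mul, mul_one] at h
    exact h
  · intro k _ hk
    rw [map_smul, ← hlin, Pi.smul_apply, hkj k hk, smul_zero]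
  · simp

/-- At each point near `t` every `vᵢ` equals some `uⱼ`. As the `uⱼ` are pairwise distinct at `t`, by
continuity the index `j` is the same at all points near `t`. -/
theorem eq_canonicalCoord_perm (ht1 : t 1 ≠ 0) {v : (Fin 3 → ℂ) → (Fin 3 → ℂ)}
    (hv : IsCanonicalCoordinatesAt domain potential euler v t) :
    ∃ σ : Equiv.Perm (Fin 3), ∀ᶠ s in 𝓝 t, ∀ i, v s i = canonicalCoord N s (σ i) := by
  obtain ⟨ψ, htψ, hψM, hψv, hd, hds, hψ⟩ := hv
  have hdel0 : ∀ s ∈ ψ.source, ∀ i, fderiv ℂ ψ.symm (ψ s) (Pi.single i 1) ≠ 0 := by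
    intro s hs i h0
    have h := fderiv_fderiv_symm_apply hs (hd.differentiableAt (ψ.open_source.mem_nhds hs))
      (hds.differentiableAt (ψ.open_target.mem_nhds (ψ.map_source hs))) (Pi.single i 1)
    rw [h0, map_zero] at h
    simpa using congrFun h i
  have hkey : ∀ s ∈ ψ.source, s 1 ≠ 0 → ∀ i, ∃ j,
      canonicalDiff N s (fderiv ℂ ψ.symm (ψ s) (Pi.single i 1)) j = 1 ∧
        v s i = canonicalCoord N s j := fun s hs hs1 i ↦
    hN.exists_canonicalDiff_eq_one (hψM hs) hs1
      (del := fun i ↦ fderiv ℂ ψ.symm (ψ s) (Pi.single i 1)) (hdel0 s hs) (hψ s hs).1 (hψ s hs).2 i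
  choose σ hσ1 hσv using hkey t htψ ht1
  have hσ : Function.Injective σ := by
    intro i k hik
    by_contra hne
    have h := congrFun (hN.canonicalDiff_mul ht (fderiv ℂ ψ.symm (ψ t) (Pi.single i 1))
      (fderiv ℂ ψ.symm (ψ t) (Pi.single k 1))) (σ i)
    rw [(hψ t htψ).1, if_neg hne, Pi.mul_apply, hσ1 i, hik, hσ1 k,
      ← hN.fderiv_canonicalCoord ht, map_zero] at h
    simp at h
  refine ⟨Equiv.ofBijective σ (Finite.injective_iff_bijective.mp hσ), ?_⟩
  have hvc : ContinuousAt v t := by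
    refine (ψ.continuousAt htψ).congr ?_
    filter_upwards [ψ.open_source.mem_nhds htψ] with s hs using hψv hs
  have huc : ContinuousAt (canonicalCoord N) t :=
    (hN.differentiableAt_canonicalCoord ht).continuousAt
  have hne : ∀ i j, j ≠ σ i → ∀ᶠ s in 𝓝 t, v s i ≠ canonicalCoord N s j := fun i j hij ↦ by
    refine ((continuousAt_pi.mp hvc i).ne_iff_eventually_ne (continuousAt_pi.mp huc j)).mp ?_
    rw [hσv i]
    exact hN.canonicalCoord_ne ht ht1 hij.symm
  have hall : ∀ᶠ s in 𝓝 t, ∀ i j, j ≠ σ i → v s i ≠ canonicalCoord N s j := by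
    simpa only [eventually_all] using hne
  filter_upwards [hall, ψ.open_source.mem_nhds htψ,
    (continuous_apply 1).continuousAt.eventually_ne ht1] with s hs hsψ hs1 i
  obtain ⟨j, -, hj⟩ := hkey s hsψ hs1 i
  by_cases hji : j = σ i
  · rw [hj, hji]
    rfl
  · exact absurd hj (hs i j hji)

end IsRootTriple

/-! ### The Poisson system -/

theorem poissonBracket_hamiltonian {s : ℂ} (hs0 : s ≠ 0) (hs1 : s ≠ 1) (x : Fin 3 → ℂ)
    (i : Fin 3) : poissonBracket (fun y ↦ y i) (hamiltonian s) x = poissonField s x i := by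
  have hs1' : s - 1 ≠ 0 := sub_ne_zero.mpr hs1
  have hc : ∀ j, pderiv j (fun y : Fin 3 → ℂ ↦ y i) x = if i = j then 1 else 0 := fun j ↦ by
    rw [pderiv, (hasFDerivAt_coord i x).fderiv]
    simp [Pi.single_apply]
  have hH : ∀ j, pderiv j (hamiltonian s) x = ![x 0 / (s - 1), x 1 / s, 0] j := fun j ↦ by
    have h : HasFDerivAt (hamiltonian s) _ x :=
      ((((hasFDerivAt_coord 0 x).pow 2).mul_const (s - 1)⁻¹).add
        (((hasFDerivAt_coord 1 x).pow 2).mul_const s⁻¹)).const_mul (1 / 2)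
    rw [pderiv, h.fderiv]
    fin_cases j <;> simp <;> ring
  simp only [poissonBracket, hc, hH, poissonField]
  fin_cases i <;> simp <;> field_simp
  ring

namespace IsRootTriple

variable {N : Fin 3 → ℂ → ℂ} (hN : IsRootTriple N)

include hN

/-- Multiplying square roots `a`, `b`, `c` of `N₂ - N₁`, `N₁ - N₃`, `N₃ - N₂` in pairs gives
branches whose product is automatically `a²b²c²`. -/
theorem exists_isSqrtTriple : ∃ R : Fin 3 → ℂ → ℂ, IsSqrtTriple N R := by
  have hsqrt : ∀ i j, (∀ τ ∈ upperHalfPlaneSet, N i τ - N j τ ≠ 0) →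
      ∃ f : ℂ → ℂ, ContinuousOn f upperHalfPlaneSet ∧ ∀ τ, f τ ^ 2 = N i τ - N j τ :=
    fun i j hij ↦ Complex.exists_continuousOn_pow_eq isSimplyConnected_upperHalfPlaneSet
      isOpen_upperHalfPlaneSet ((hN.continuousOn i).sub (hN.continuousOn j))
      (fun ⟨τ, hτ, h0⟩ ↦ hij τ hτ h0) two_ne_zero
  obtain ⟨a, hac, ha⟩ := hsqrt 1 0 fun τ hτ ↦ by
    rw [← neg_sub]; exact neg_ne_zero.mpr (hN.sub_ne_zero_01 hτ)
  obtain ⟨b, hbc, hb⟩ := hsqrt 0 2 fun τ hτ ↦ hN.sub_ne_zero_02 hτ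
  obtain ⟨c, hcc, hc⟩ := hsqrt 2 1 fun τ hτ ↦ by
    rw [← neg_sub]; exact neg_ne_zero.mpr (hN.sub_ne_zero_12 hτ)
  refine ⟨![fun τ ↦ a τ * b τ, fun τ ↦ c τ * a τ, fun τ ↦ b τ * c τ], fun i ↦ ?_, fun τ _ ↦ ?_,
    fun τ _ ↦ ?_, fun τ _ ↦ ?_, fun τ _ ↦ ?_⟩
  · fin_cases i
    exacts [hac.mul hbc, hcc.mul hac, hbc.mul hcc]
  · simp [mul_pow, ha, hb]
  · simp [mul_pow, ha, hc]
  · simp [mul_pow, hb, hc]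
  · rw [← ha, ← hb, ← hc]
    simp only [Matrix.cons_val_zero, Matrix.cons_val_one, Matrix.cons_val]
    ring

variable {τ : ℂ} (hτ : τ ∈ upperHalfPlaneSet)

include hτ

lemma hasDerivAt_sVar :
    HasDerivAt (sVar N) (2 * (N 1 τ - N 2 τ) * -sVar N τ) τ := by
  have h10 : N 1 τ - N 0 τ ≠ 0 := by
    rw [← neg_sub]; exact neg_ne_zero.mpr (hN.sub_ne_zero_01 hτ)
  refine (((hN.hasDerivAt_two hτ).sub (hN.hasDerivAt_zero hτ)).div
    ((hN.hasDerivAt_one hτ).sub (hN.hasDerivAt_zero hτ)) h10).congr_deriv ?_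
  simp only [sVar, Pi.sub_apply]
  field_simp
  ring

lemma sVar_ne_zero : sVar N τ ≠ 0 :=
  div_ne_zero (by rw [← neg_sub]; exact neg_ne_zero.mpr (hN.sub_ne_zero_02 hτ))
    (by rw [← neg_sub]; exact neg_ne_zero.mpr (hN.sub_ne_zero_01 hτ))

lemma sVar_sub_one : sVar N τ - 1 = (N 2 τ - N 1 τ) / (N 1 τ - N 0 τ) := by
  have h10 : N 1 τ - N 0 τ ≠ 0 := by
    rw [← neg_sub]; exact neg_ne_zero.mpr (hN.sub_ne_zero_01 hτ)
  rw [sVar]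
  field_simp
  ring

lemma sVar_sub_one_ne_zero : sVar N τ - 1 ≠ 0 := by
  rw [hN.sVar_sub_one hτ]
  exact div_ne_zero (by rw [← neg_sub]; exact neg_ne_zero.mpr (hN.sub_ne_zero_12 hτ))
    (by rw [← neg_sub]; exact neg_ne_zero.mpr (hN.sub_ne_zero_01 hτ))

end IsRootTriple

/-- A continuous square root of a nonvanishing differentiable function is differentiable. -/
lemma hasDerivAt_of_sq_eq {f g : ℂ → ℂ} {g' τ : ℂ} (hf : ContinuousAt f τ) (hf0 : f τ ≠ 0)
    (h : ∀ᶠ z in 𝓝 τ, f z ^ 2 = g z) (hg : HasDerivAt g g' τ) :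
    HasDerivAt f (g' / (2 * f τ)) τ := by
  have h2 : f τ + f τ ≠ 0 := by
    rw [← two_mul]
    exact mul_ne_zero two_ne_zero hf0
  have := hasDerivAt_of_sub_mul_eq (f := f) (A := fun z ↦ f z + f τ) (B := fun z ↦ g z - g τ)
    (by
      filter_upwards [h] with z hz
      rw [← hz, ← h.self_of_nhds]
      ring) (hf.add continuousAt_const) h2 (hg.sub_const _)
  exact this.congr_deriv (by rw [two_mul])

namespace IsSqrtTriple

variable {N R : Fin 3 → ℂ → ℂ} (hR : IsSqrtTriple N R) (hN : IsRootTriple N) {τ : ℂ}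
  (hτ : τ ∈ upperHalfPlaneSet)

include hR hN hτ

lemma prod_ne_zero : R 0 τ * R 1 τ * R 2 τ ≠ 0 := by
  rw [hR.prod τ hτ]
  intro h
  exact hN.vandermonde_ne_zero hτ (by linear_combination h)

lemma ne_zero (i : Fin 3) : R i τ ≠ 0 := by
  have h := hR.prod_ne_zero hN hτ
  fin_cases i
  exacts [left_ne_zero_of_mul (left_ne_zero_of_mul h), right_ne_zero_of_mul (left_ne_zero_of_mul h),
    right_ne_zero_of_mul h]

omit hN in
lemma continuousAt (i : Fin 3) : ContinuousAt (R i) τ :=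
  (hR.continuousOn i).continuousAt (isOpen_upperHalfPlaneSet.mem_nhds hτ)

/-- By the Halphen system `(N₂ - N₁)' = -2 N₃ (N₂ - N₁)`, and so on cyclically, whence
`R₁' = -(N₂ + N₃) R₁`; this cancels the terms of `N₁'` that are linear in `N₂`, `N₃`. -/
lemma hasDerivAt_Ω_zero :
    HasDerivAt (fun z ↦ Ω N R z 0) (N 1 τ * N 2 τ / (2 * R 0 τ)) τ := by
  have h0 := hR.ne_zero hN hτ 0
  have hRd := hasDerivAt_of_sq_eq (hR.continuousAt hτ 0) h0
    (by filter_upwards [eventually_mem_upperHalfPlaneSet hτ] with z hz using hR.sq_zero z hz)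
    (((hN.hasDerivAt_one hτ).sub (hN.hasDerivAt_zero hτ)).mul
      ((hN.hasDerivAt_zero hτ).sub (hN.hasDerivAt_two hτ)))
  refine ((hN.hasDerivAt_zero hτ).div (hRd.const_mul 2)
    (mul_ne_zero two_ne_zero h0)).congr_deriv ?_
  simp only [Pi.sub_apply]
  have hsq := hR.sq_zero τ hτ
  field_simp
  linear_combination (-2 * N 0 τ * (N 1 τ + N 2 τ)) * hsq

lemma hasDerivAt_Ω_one :
    HasDerivAt (fun z ↦ Ω N R z 1) (N 0 τ * N 2 τ / (2 * R 1 τ)) τ := by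
  have h0 := hR.ne_zero hN hτ 1
  have hRd := hasDerivAt_of_sq_eq (hR.continuousAt hτ 1) h0
    (by filter_upwards [eventually_mem_upperHalfPlaneSet hτ] with z hz using hR.sq_one z hz)
    (((hN.hasDerivAt_two hτ).sub (hN.hasDerivAt_one hτ)).mul
      ((hN.hasDerivAt_one hτ).sub (hN.hasDerivAt_zero hτ)))
  refine ((hN.hasDerivAt_one hτ).div (hRd.const_mul 2)
    (mul_ne_zero two_ne_zero h0)).congr_deriv ?_
  simp only [Pi.sub_apply]
  have hsq := hR.sq_one τ hτ
  field_simp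
  linear_combination (-2 * N 1 τ * (N 0 τ + N 2 τ)) * hsq

lemma hasDerivAt_Ω_two :
    HasDerivAt (fun z ↦ Ω N R z 2) (N 0 τ * N 1 τ / (2 * R 2 τ)) τ := by
  have h0 := hR.ne_zero hN hτ 2
  have hRd := hasDerivAt_of_sq_eq (hR.continuousAt hτ 2) h0
    (by filter_upwards [eventually_mem_upperHalfPlaneSet hτ] with z hz using hR.sq_two z hz)
    (((hN.hasDerivAt_zero hτ).sub (hN.hasDerivAt_two hτ)).mul
      ((hN.hasDerivAt_two hτ).sub (hN.hasDerivAt_one hτ)))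
  refine ((hN.hasDerivAt_two hτ).div (hRd.const_mul 2)
    (mul_ne_zero two_ne_zero h0)).congr_deriv ?_
  simp only [Pi.sub_apply]
  have hsq := hR.sq_two τ hτ
  field_simp
  linear_combination (-2 * N 2 τ * (N 0 τ + N 1 τ)) * hsq

/-- The chain-rule form `dΩ/dτ = (ds/dτ) V(s, Ω)` of the Poisson system. -/
lemma hasDerivAt_Ω :
    HasDerivAt (Ω N R)
      ((2 * (N 1 τ - N 2 τ) * -sVar N τ) • poissonField (sVar N τ) (Ω N R τ)) τ := by
  have h0 := hR.ne_zero hN hτ 0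
  have h1 := hR.ne_zero hN hτ 1
  have h2 := hR.ne_zero hN hτ 2
  have hs := hN.sVar_ne_zero hτ
  have hs1 := hN.sVar_sub_one_ne_zero hτ
  have h01 := hN.sub_ne_zero_01 hτ
  have h02 := hN.sub_ne_zero_02 hτ
  have h12 := hN.sub_ne_zero_12 hτ
  have h10 : N 1 τ - N 0 τ ≠ 0 := by rw [← neg_sub]; exact neg_ne_zero.mpr h01
  have h20 : N 2 τ - N 0 τ ≠ 0 := by rw [← neg_sub]; exact neg_ne_zero.mpr h02
  have h21 : N 2 τ - N 1 τ ≠ 0 := by rw [← neg_sub]; exact neg_ne_zero.mpr h12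
  have hp := hR.prod τ hτ
  have hR0 : R 1 τ * R 2 τ = R 0 τ * (N 2 τ - N 1 τ) := mul_left_cancel₀ h0 (by
    linear_combination hp - (N 2 τ - N 1 τ) * hR.sq_zero τ hτ)
  have hR1 : R 0 τ * R 2 τ = R 1 τ * (N 0 τ - N 2 τ) := mul_left_cancel₀ h1 (by
    linear_combination hp - (N 0 τ - N 2 τ) * hR.sq_one τ hτ)
  have hR2 : R 0 τ * R 1 τ = R 2 τ * (N 1 τ - N 0 τ) := mul_left_cancel₀ h2 (by
    linear_combination hp - (N 1 τ - N 0 τ) * hR.sq_two τ hτ)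
  refine hasDerivAt_pi.mpr fun i ↦ ?_
  fin_cases i
  · refine (hR.hasDerivAt_Ω_zero hN hτ).congr_deriv ?_
    simp only [poissonField, Ω, Fin.zero_eta, Pi.smul_apply, smul_eq_mul, Matrix.cons_val_zero]
    rw [show N 1 τ / (2 * R 1 τ) * (N 2 τ / (2 * R 2 τ)) = N 1 τ * N 2 τ /
      (4 * (R 0 τ * (N 2 τ - N 1 τ))) by rw [← hR0]; field_simp; ring]
    field_simp
    ring
  · refine (hR.hasDerivAt_Ω_one hN hτ).congr_deriv ?_
    simp only [poissonField, Ω, Fin.mk_one, Pi.smul_apply, smul_eq_mul, Matrix.cons_val_one,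
      Matrix.cons_val_zero]
    rw [show N 0 τ / (2 * R 0 τ) * (N 2 τ / (2 * R 2 τ)) = N 0 τ * N 2 τ /
      (4 * (R 1 τ * (N 0 τ - N 2 τ))) by rw [← hR1]; field_simp; ring, hN.sVar_sub_one hτ, sVar]
    field_simp
    ring
  · refine (hR.hasDerivAt_Ω_two hN hτ).congr_deriv ?_
    simp only [poissonField, Ω, Fin.reduceFinMk, Pi.smul_apply, smul_eq_mul, Matrix.cons_val]
    rw [show N 0 τ / (2 * R 0 τ) * (N 1 τ / (2 * R 1 τ)) = N 0 τ * N 1 τ /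
      (4 * (R 2 τ * (N 1 τ - N 0 τ))) by rw [← hR2]; field_simp; ring, hN.sVar_sub_one hτ]
    field_simp
    ring

theorem solvesInVariableAt : SolvesInVariableAt (sVar N) poissonField (Ω N R) τ := by
  have hs' : ∀ z ∈ upperHalfPlaneSet, 2 * (N 1 z - N 2 z) * -sVar N z ≠ 0 := fun z hz ↦
    mul_ne_zero (mul_ne_zero two_ne_zero (hN.sub_ne_zero_12 hz))
      (neg_ne_zero.mpr (hN.sVar_ne_zero hz))
  have hC : ContDiffOn ℂ 1 (sVar N) upperHalfPlaneSet := DifferentiableOn.contDiffOn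
    (fun z hz ↦ (hN.hasDerivAt_sVar hz).differentiableAt.differentiableWithinAt)
    isOpen_upperHalfPlaneSet
  obtain ⟨φ, hτφ, hφU, hφ, hd, hds⟩ := exists_holomorphic_chart isOpen_upperHalfPlaneSet hC
    (fun z hz ↦ by
      intro v w hvw
      rw [(hN.hasDerivAt_sVar hz).hasFDerivAt.fderiv] at hvw
      exact mul_right_cancel₀ (hs' z hz) hvw) hτ
  refine ⟨φ, hτφ, hφU, fun z _ ↦ (congrFun hφ z).symm, hd, hds, fun z hz ↦ ?_⟩
  have hσ := hφU (φ.map_target hz)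
  have hz' : sVar N (φ.symm z) = z := (congrFun hφ _).trans (φ.right_inv hz)
  refine ⟨?_, ?_, ?_⟩
  · rw [← hz']
    exact hN.sVar_ne_zero hσ
  · rw [← hz']
    exact sub_ne_zero.mp (hN.sVar_sub_one_ne_zero hσ)
  · have hsd := hN.hasDerivAt_sVar hσ
    rw [hφ] at hsd
    have h1 := φ.hasDerivAt_symm hz (hφ ▸ hs' _ hσ) hsd
    have h2 := (hR.hasDerivAt_Ω hN hσ).scomp z h1
    refine h2.congr_deriv ?_
    rw [← hφ, smul_smul, inv_mul_cancel₀ (hs' _ hσ), one_smul, hz']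

end IsSqrtTriple

end FrobeniusChazy

end

theorem mainTheorem1 :
    -- the Frobenius manifold and its flat metric `dt₂² + 2 dt₁ dt₃`
    FrobeniusChazy.IsFrobeniusManifold FrobeniusChazy.domain FrobeniusChazy.potential
      FrobeniusChazy.euler 1 ∧
    (∀ t ∈ FrobeniusChazy.domain, ∀ v w : Fin 3 → ℂ,
      FrobeniusChazy.metric FrobeniusChazy.potential t v w =
        v 1 * w 1 + (v 0 * w 2 + v 2 * w 0)) ∧
    -- the Hamiltonian equations `dΩᵢ/ds = {Ωᵢ, H}` in explicit form
    (∀ s : ℂ, s ≠ 0 → s ≠ 1 → ∀ (x : Fin 3 → ℂ) (i : Fin 3),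
      FrobeniusChazy.poissonBracket (fun y => y i) (FrobeniusChazy.hamiltonian s) x =
        FrobeniusChazy.poissonField s x i) ∧
    -- the roots of the cubic
    (∃ N : Fin 3 → ℂ → ℂ, FrobeniusChazy.IsRootTriple N) ∧
    ∀ N : Fin 3 → ℂ → ℂ, FrobeniusChazy.IsRootTriple N →
      (∀ τ ∈ UpperHalfPlane.upperHalfPlaneSet, Function.Injective fun i => N i τ) ∧
      -- canonical coordinates on `t₂ ≠ 0`: existence and uniqueness up to order
      (∀ p ∈ FrobeniusChazy.domain, p 1 ≠ 0 →
        FrobeniusChazy.IsCanonicalCoordinatesAt FrobeniusChazy.domain FrobeniusChazy.potential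
          FrobeniusChazy.euler (FrobeniusChazy.canonicalCoord N) p ∧
        ∀ v : (Fin 3 → ℂ) → (Fin 3 → ℂ),
          FrobeniusChazy.IsCanonicalCoordinatesAt FrobeniusChazy.domain FrobeniusChazy.potential
            FrobeniusChazy.euler v p →
          ∃ σ : Equiv.Perm (Fin 3), ∀ᶠ t in nhds p, ∀ i,
            v t i = FrobeniusChazy.canonicalCoord N t (σ i)) ∧
      -- the solution of the Poisson system
      (∃ R : Fin 3 → ℂ → ℂ, FrobeniusChazy.IsSqrtTriple N R) ∧
      ∀ R : Fin 3 → ℂ → ℂ, FrobeniusChazy.IsSqrtTriple N R →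
        ∀ τ ∈ UpperHalfPlane.upperHalfPlaneSet,
          FrobeniusChazy.SolvesInVariableAt (FrobeniusChazy.sVar N) FrobeniusChazy.poissonField
            (FrobeniusChazy.Ω N R) τ := by
  refine ⟨FrobeniusChazy.isFrobeniusManifold_potential,
    fun t ht ↦ FrobeniusChazy.metric_potential ht,
    fun s hs0 hs1 ↦ FrobeniusChazy.poissonBracket_hamiltonian hs0 hs1,
    FrobeniusChazy.exists_isRootTriple, fun N hN ↦ ⟨fun τ hτ ↦ hN.injective hτ, fun p hp hp1 ↦
      ⟨hN.isCanonicalCoordinatesAt hp hp1, fun v hv ↦ hN.eq_canonicalCoord_perm hp hp1 hv⟩,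
      hN.exists_isSqrtTriple, fun R hR τ hτ ↦ hR.solvesInVariableAt hN hτ⟩⟩
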